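/- **Theorem (non-team defeat simulates team defeat).** *Theories.* Literals are $p,\neg p$ for propositions $p$; ${\sim}q$ is the complement of $q$. A defeasible theory $D=(F,R,>)$ consists of a set $F$ of facts (literals), a finite set $R$ of labelled rules with a finite set of literals $A(r)$ as body and a literal as head, each strict ($\rightarrow$), defeasible ($\Rightarrow$) or a defeater ($\leadsto$), and an acyclic relation $>$ on $R$. It comes with a language $\Sigma(D)$, closed under negation, that contains all its literals. $R_s[q]$, $R_{sd}[q]$, $R[q]$ are the strict, the strict or defeasible, and all rules with head $q$. The size of $D$ is the number of symbols in it, each literal occurrence (including those of the new propositions below), label, arrow and $>$ counting as one. *Conclusions.* Conclusions are tagged literals $\pm d\,q$. $D\vdash\alpha$ means that $\alpha$ lies in the least set $E$ closed under the following rules; the rules for the negative tags are their strong negations (exchange $+$ and $-$, $\exists$ and $\forall$, "and" and "or", and negate conditions on $F$ and $>$). * $+\Delta q$: $q\in F$, or some $r\in R_s[q]$ has $+\Delta a\in E$ for all $a\in A(r)$. * Team defeat, with $(d,c)=(\partial,\partial)$ or $(\delta,\sigma)$. $+d\,q$: $+\Delta q\in E$; or (i) some $r\in R_{sd}[q]$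 has $+d\,a\in E$ for all $a\in A(r)$, (ii) $-\Delta{\sim}q\in E$, and (iii) each $s\in R[{\sim}q]$ has some $a\in A(s)$ with $-c\,a\in E$, or there is $t\in R_{sd}[q]$ with $t>s$ and $+d\,a\in E$ for all $a\in A(t)$. * No team defeat, with $(d,c)=(\partial^*,\partial^*)$ or $(\delta^*,\sigma^*)$. $+d\,q$: $+\Delta q\in E$; or there is $r\in R_{sd}[q]$ such that $+d\,a\in E$ for all $a\in A(r)$, $-\Delta{\sim}q\in E$, and each $s\in R[{\sim}q]$ has some $a\in A(s)$ with $-c\,a\in E$, or $r>s$. * Support, with $(d,c)=(\delta,\sigma)$ or $(\delta^*,\sigma^*)$. $+c\,q$: $+\Delta q\in E$; or there is $r\in R_{sd}[q]$ such that $+c\,a\in E$ for all $a\in A(r)$, and each $s\in R[{\sim}q]$ has some $a\in A(s)$ with $-d\,a\in E$, or not $s>r$. *Simulation.* $D_1$ in ${\bf DL}(d_1)$ is simulated by $D_2$ in ${\bf DL}(d_2)$ with respect to addition of facts if, for every set $A$ of facts with $\Sigma(A)\cap\Sigma(D_2)\subseteq\Sigma(D_1)$ and every literal $q\in\Sigma(D_1)$,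 we have $D_1+A\vdash\pm\Delta q$ iff $D_2+A\vdash\pm\Delta q$, and $D_1+A\vdash\pm d_1q$ iff $D_2+A\vdash\pm d_2q$, where $D_i+A$ is $D_i$ with the facts $A$ added. ($D_2$ may use new propositions.) *The translation.* For $D=(F,R,>)$ let $T(D)=(F,R',>')$, with new propositions $\mathrm{strict}(q)$, $d(r_i,r_j)$, $d(r)$, $\mathrm{fail}(r)$, $\mathrm{one}(q)$. Its language consists of $\Sigma(D)$ and the propositions that occur in $R'$, and $R'$ consists of: 1. for each strict rule $r=(B\rightarrow q)$: $\;ns(q):\ \Rightarrow\neg\mathrm{strict}(q)$; $\;s(r):\ B\rightarrow\mathrm{strict}(q)$; $\;\mathrm{strict}(q)\rightarrow q$; with $ns(q)>'s(r)$; 2. for all rules $r_i=(B_i\hookrightarrow_i{\sim}q)$ and $r_j=(B_j\hookrightarrow_j q)$, $r_j$ not a defeater: $\;R1_{ij}:\ B_i\hookrightarrow_i\neg d(r_i,r_j)$; $\;R2_{ij}:\ B_j\Rightarrow d(r_i,r_j)$; $\;R3_{ij}:\ \mathrm{strict}(q)\Rightarrow d(r_i,r_j)$; $\;d(r_i,r_j)\Rightarrow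 d(r_i)$; with $R2_{ij}>'R1_{ij}$ iff $r_j>r_i$, and $R3_{ij}>'R1_{ij}$ always; 3. for each rule $r_i$ with body $B_i$: $\;\mathrm{fail}(r_i)\Rightarrow d(r_i)$; $\;NF_i:\ B_i\Rightarrow\neg\mathrm{fail}(r_i)$; $\;F_i:\ \Rightarrow\mathrm{fail}(r_i)$; with $NF_i>'F_i$; 4. for each strict or defeasible rule with body $B$ and head $q$: $\;B\Rightarrow\mathrm{one}(q)$; 5. for each literal $q$ such that $q$ or ${\sim}q$ occurs in $R$: $\;\mathrm{one}(q),d(r_1),\dots,d(r_k)\Rightarrow q$, where $r_1,\dots,r_k$ are the rules for ${\sim}q$. *Claim.* There is a constant $C$ such that: * every defeasible theory $D$ in ${\bf DL}(\partial)$ is simulated by some defeasible theory $D'$ in ${\bf DL}(\partial^*)$ with respect to addition of facts, and $\mathrm{size}(D')\le C\,\mathrm{size}(D)^2$; * every defeasible theory $D$ in ${\bf DL}(\delta)$ is simulated by some defeasible theory $D'$ in ${\bf DL}(\delta^*)$ with respect to addition of facts, and $\mathrm{size}(D')\le C\,\mathrm{size}(D)^2$; * for ${\bf DL}(\partial)$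 and ${\bf DL}(\partial^*)$ one can take $D'=T(D)$: for every defeasible theory $D$, $T(D)$ is a defeasible theory, $\mathrm{size}(T(D))\le C\,\mathrm{size}(D)^2$, and $D$ in ${\bf DL}(\partial)$ is simulated by $T(D)$ in ${\bf DL}(\partial^*)$ with respect to addition of facts. -/

import Mathlib

universe u

/-! ## Defeasible theories -/

/-- Literals over a type `U` of propositions. -/
inductive Lit (U : Type*) where
  | pos (p : U)
  | neg (p : U)

namespace Lit

/-- The complement `∼q`. -/
def compl {U : Type*} : Lit U → Lit U
  | pos p => neg p
  | neg p => pos p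

/-- The proposition of a literal. -/
def atom {U : Type*} : Lit U → U
  | pos p => p
  | neg p => p

/-- Renaming of propositions. -/
def map {U V : Type*} (f : U → V) : Lit U → Lit V
  | pos p => pos (f p)
  | neg p => neg (f p)

end Lit

/-- The three kinds of rules: strict `→`, defeasible `⇒`, defeater `⇝`. -/
inductive Arrow where
  | strict
  | defeasible
  | defeater

/-- Labelled rules `label : body ↪ head`; the body is a finite set of literals. -/
structure Rule (U : Type*) (L : Type*) where
  label : L
  body : Finset (Lit U)
  arrow : Arrow
  head : Lit U

/-- A triple `(F, R, >)` over a language. The language, which is closed under negation, is given by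
its set of propositions. A pair `(r, s)` in `sup` means `r > s`. -/
structure Theory (U : Type*) (L : Type*) where
  lang : Set U
  facts : Set (Lit U)
  rules : Finset (Rule U L)
  sup : Finset (Rule U L × Rule U L)

namespace Theory

/-- `D` is a defeasible theory: its literals belong to its language, and the superiority relation
is an acyclic relation on its rules. -/
structure IsDefeasible {U L : Type*} (D : Theory U L) : Prop where
  facts_mem : ∀ q ∈ D.facts, q.atom ∈ D.lang
  head_mem : ∀ r ∈ D.rules, r.head.atom ∈ D.lang
  body_mem : ∀ r ∈ D.rules, ∀ a ∈ r.body, a.atom ∈ D.lang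
  sup_mem : ∀ x ∈ D.sup, x.1 ∈ D.rules ∧ x.2 ∈ D.rules
  acyclic : ∀ r, ¬ Relation.TransGen (fun s t => (s, t) ∈ D.sup) r r

/-- The size: the number of symbols, where each occurrence of a literal, a label, an arrow or
the sign `>` is one symbol. It is `⊤` exactly if there are infinitely many facts. -/
noncomputable def size {U L : Type*} (D : Theory U L) : ℕ∞ :=
  D.facts.encard + ((∑ r ∈ D.rules, (r.body.card + 3) + 3 * D.sup.card : ℕ) : ℕ∞)

/-- The addition `D + (A, ∅, ∅)` of a set `A` of facts. -/
def addFacts {U L : Type*} (D : Theory U L) (A : Set (Lit U)) : Theory U L where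
  lang := D.lang ∪ Lit.atom '' A
  facts := D.facts ∪ A
  rules := D.rules
  sup := D.sup

open Classical in
/-- The same theory, with the propositions read as elements of a larger stock `V`. -/
noncomputable def map {U V L : Type*} (ι : U ↪ V) (D : Theory U L) : Theory V L :=
  let f : Rule U L → Rule V L :=
    fun r => ⟨r.label, r.body.image (Lit.map ι), r.arrow, r.head.map ι⟩
  { lang := ι '' D.lang
    facts := Lit.map ι '' D.facts
    rules := D.rules.image f
    sup := D.sup.image (Prod.map f f) }

end Theory

/-! ## Conclusions and inference rules -/

/-- The tags `Δ, ∂, ∂*, δ, σ, δ*, σ*`. -/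
inductive Tag where
  | Delta
  | partial_
  | partialStar
  | delta
  | sigma
  | deltaStar
  | sigmaStar

/-- Conclusions `+d q` and `-d q`. -/
inductive Conclusion (U : Type*) where
  | plus (d : Tag) (q : Lit U)
  | minus (d : Tag) (q : Lit U)

namespace Theory

open Conclusion

section Clauses

variable {U L : Type*} (D : Theory U L) (E : Set (Conclusion U))

/-- `R[q]` -/
def R (q : Lit U) : Set (Rule U L) := {r | r ∈ D.rules ∧ r.head = q}

/-- `R_s[q]` -/
def Rs (q : Lit U) : Set (Rule U L) := {r | r ∈ D.R q ∧ r.arrow = Arrow.strict}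

/-- `R_sd[q]` -/
def Rsd (q : Lit U) : Set (Rule U L) := {r | r ∈ D.R q ∧ r.arrow ≠ Arrow.defeater}

/-- The inference rule `+Δ`. -/
def PlusDelta (q : Lit U) : Prop :=
  q ∈ D.facts ∨ ∃ r ∈ D.Rs q, ∀ a ∈ r.body, plus .Delta a ∈ E

/-- The inference rule `-Δ`. -/
def MinusDelta (q : Lit U) : Prop :=
  q ∉ D.facts ∧ ∀ r ∈ D.Rs q, ∃ a ∈ r.body, minus .Delta a ∈ E

/-- The inference rule `+d` with team defeat, where `c` is the tag under which the bodies of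
opposing rules are evaluated: `+∂` for `d = c = ∂`, and `+δ` for `d = δ`, `c = σ`. -/
def PlusTeam (d c : Tag) (q : Lit U) : Prop :=
  plus .Delta q ∈ E ∨
    ((∃ r ∈ D.Rsd q, ∀ a ∈ r.body, plus d a ∈ E) ∧
      minus .Delta q.compl ∈ E ∧
      ∀ s ∈ D.R q.compl,
        (∃ a ∈ s.body, minus c a ∈ E) ∨
        ∃ t ∈ D.Rsd q, (∀ a ∈ t.body, plus d a ∈ E) ∧ (t, s) ∈ D.sup)

/-- The inference rule `-d` with team defeat. -/
def MinusTeam (d c : Tag) (q : Lit U) : Prop :=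
  minus .Delta q ∈ E ∧
    ((∀ r ∈ D.Rsd q, ∃ a ∈ r.body, minus d a ∈ E) ∨
      plus .Delta q.compl ∈ E ∨
      ∃ s ∈ D.R q.compl,
        (∀ a ∈ s.body, plus c a ∈ E) ∧
        ∀ t ∈ D.Rsd q, (∃ a ∈ t.body, minus d a ∈ E) ∨ (t, s) ∉ D.sup)

/-- The inference rule `+d` without team defeat: `+∂*` for `d = c = ∂*`, and `+δ*` for
`d = δ*`, `c = σ*`. -/
def PlusSingle (d c : Tag) (q : Lit U) : Prop :=
  plus .Delta q ∈ E ∨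
    ∃ r ∈ D.Rsd q,
      (∀ a ∈ r.body, plus d a ∈ E) ∧
      minus .Delta q.compl ∈ E ∧
      ∀ s ∈ D.R q.compl, (∃ a ∈ s.body, minus c a ∈ E) ∨ (r, s) ∈ D.sup

/-- The inference rule `-d` without team defeat. -/
def MinusSingle (d c : Tag) (q : Lit U) : Prop :=
  minus .Delta q ∈ E ∧
    ∀ r ∈ D.Rsd q,
      (∃ a ∈ r.body, minus d a ∈ E) ∨
      plus .Delta q.compl ∈ E ∨
      ∃ s ∈ D.R q.compl, (∀ a ∈ s.body, plus c a ∈ E) ∧ (r, s) ∉ D.sup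

/-- The inference rule for support `+c` relative to the main tag `d`: `+σ` for `d = δ`, `c = σ`,
and `+σ*` for `d = δ*`, `c = σ*`. -/
def PlusSupport (d c : Tag) (q : Lit U) : Prop :=
  plus .Delta q ∈ E ∨
    ∃ r ∈ D.Rsd q,
      (∀ a ∈ r.body, plus c a ∈ E) ∧
      ∀ s ∈ D.R q.compl, (∃ a ∈ s.body, minus d a ∈ E) ∨ (s, r) ∉ D.sup

/-- The inference rule for `-c`, for support. -/
def MinusSupport (d c : Tag) (q : Lit U) : Prop :=
  minus .Delta q ∈ E ∧
    ∀ r ∈ D.Rsd q,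
      (∃ a ∈ r.body, minus c a ∈ E) ∨
      ∃ s ∈ D.R q.compl, (∀ a ∈ s.body, plus d a ∈ E) ∧ (s, r) ∈ D.sup

/-- The conclusions inferred from `E` by one application of an inference rule. The rules of all
four logics are put together; those of one logic do not refer to the tags of another,
except for `Δ`, which all logics share. -/
def Infers : Conclusion U → Prop
  | plus .Delta q => D.PlusDelta E q
  | minus .Delta q => D.MinusDelta E q
  | plus .partial_ q => D.PlusTeam E .partial_ .partial_ q
  | minus .partial_ q => D.MinusTeam E .partial_ .partial_ q
  | plus .partialStar q => D.PlusSingle E .partialStar .partialStar q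
  | minus .partialStar q => D.MinusSingle E .partialStar .partialStar q
  | plus .delta q => D.PlusTeam E .delta .sigma q
  | minus .delta q => D.MinusTeam E .delta .sigma q
  | plus .sigma q => D.PlusSupport E .delta .sigma q
  | minus .sigma q => D.MinusSupport E .delta .sigma q
  | plus .deltaStar q => D.PlusSingle E .deltaStar .sigmaStar q
  | minus .deltaStar q => D.MinusSingle E .deltaStar .sigmaStar q
  | plus .sigmaStar q => D.PlusSupport E .deltaStar .sigmaStar q
  | minus .sigmaStar q => D.MinusSupport E .deltaStar .sigmaStar q

end Clauses

theorem infers_mono {U L : Type*} (D : Theory U L) {E E' : Set (Conclusion U)} (h : E ⊆ E')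
    (c : Conclusion U) (hc : D.Infers E c) : D.Infers E' c := by
  have h' : ∀ x, x ∈ E → x ∈ E' := fun x hx => h hx
  rcases c with ⟨d, q⟩ | ⟨d, q⟩ <;> cases d <;>
    simp only [Infers, PlusDelta, MinusDelta, PlusTeam, MinusTeam, PlusSingle, MinusSingle,
      PlusSupport, MinusSupport] at hc ⊢ <;> grind

/-- The monotone operator `𝒯_D` on sets of conclusions. -/
def step {U L : Type*} (D : Theory U L) : Set (Conclusion U) →o Set (Conclusion U) where
  toFun E := {c | D.Infers E c}
  monotone' _ _ h c hc := D.infers_mono h c hc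

/-- `D ⊢ c`: the conclusion `c` lies in the least fixed point of `𝒯_D`. -/
def Proves {U L : Type*} (D : Theory U L) (c : Conclusion U) : Prop :=
  c ∈ OrderHom.lfp D.step

/-- `D₁` in `DL(d₁)` is simulated by `D₂` in `DL(d₂)` with respect to addition of facts: for
every set `A` of facts with `Σ(A) ∩ Σ(D₂) ⊆ Σ(D₁)`, the theories `D₁ + A` and `D₂ + A` have the
same strict and defeasible conclusions in `Σ(D₁)`, up to exchanging the tags `d₁` and `d₂`. -/
def SimulatedBy {U L₁ L₂ : Type*} (d₁ d₂ : Tag) (D₁ : Theory U L₁) (D₂ : Theory U L₂) : Prop :=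
  ∀ A : Set (Lit U), Lit.atom '' A ∩ D₂.lang ⊆ D₁.lang →
    ∀ q : Lit U, q.atom ∈ D₁.lang →
      ((D₁.addFacts A).Proves (plus .Delta q) ↔ (D₂.addFacts A).Proves (plus .Delta q)) ∧
      ((D₁.addFacts A).Proves (minus .Delta q) ↔ (D₂.addFacts A).Proves (minus .Delta q)) ∧
      ((D₁.addFacts A).Proves (plus d₁ q) ↔ (D₂.addFacts A).Proves (plus d₂ q)) ∧
      ((D₁.addFacts A).Proves (minus d₁ q) ↔ (D₂.addFacts A).Proves (minus d₂ q))

end Theory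

/-- The logic `DL(d₁)` can be simulated by the logic `DL(d₂)` with respect to addition of facts, by
theories of size at most `b n` for theories of size `n`. The stock `U` of propositions
is embedded into a larger one that provides new propositions for the simulating theory. -/
def CanBeSimulatedWithin (b : ℕ∞ → ℕ∞) (d₁ d₂ : Tag) : Prop :=
  ∀ (U L : Type u) (D : Theory U L), D.IsDefeasible →
    ∃ (V L' : Type u) (ι : U ↪ V) (D' : Theory V L'),
      D'.IsDefeasible ∧ D'.size ≤ b D.size ∧ (D.map ι).SimulatedBy d₁ d₂ D'

/-! ## The translation -/

/-- The propositions of the translated theory: the old ones, and the new propositions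
`strict(q)`, `d(r, r')`, `d(r)`, `fail(r)` and `one(q)`. -/
inductive PropSym (U L : Type*) where
  | old (p : U)
  | strict (q : Lit U)
  | defeatedBy (r r' : Rule U L)
  | defeated (r : Rule U L)
  | fail (r : Rule U L)
  | one (q : Lit U)

/-- The old propositions among those of the translated theory. -/
def PropSym.oldEmb (U L : Type*) : U ↪ PropSym U L := ⟨PropSym.old, fun _ _ h => by injection h⟩

/-- The labels of the rules of the translated theory. -/
inductive TLabel (U L : Type*) where
  | ns (q : Lit U)
  | s (r : Rule U L)
  | strictHead (q : Lit U)
  | R1 (r r' : Rule U L)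
  | R2 (r r' : Rule U L)
  | R3 (r r' : Rule U L)
  | viaDefeat (r r' : Rule U L)
  | viaFail (r : Rule U L)
  | NF (r : Rule U L)
  | F (r : Rule U L)
  | one (r : Rule U L)
  | main (q : Lit U)

namespace Translation

open Lit Classical

section TranslatedRules

variable {U L : Type*}

/-- A set of old literals, as literals of the translated theory. -/
noncomputable def oldBody (B : Finset (Lit U)) : Finset (Lit (PropSym U L)) := B.image (Lit.map PropSym.old)

/-- `ns(q) : ⇒ ¬strict(q)` -/
noncomputable def ns (q : Lit U) : Rule (PropSym U L) (TLabel U L) :=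
  ⟨.ns q, ∅, .defeasible, neg (.strict q)⟩

/-- `s(r) : B → strict(q)`, for `r = (B → q)` -/
noncomputable def s (r : Rule U L) : Rule (PropSym U L) (TLabel U L) :=
  ⟨.s r, oldBody r.body, .strict, pos (.strict r.head)⟩

/-- `strict(q) → q` -/
noncomputable def strictHead (q : Lit U) : Rule (PropSym U L) (TLabel U L) :=
  ⟨.strictHead q, {pos (.strict q)}, .strict, q.map .old⟩

/-- `R1ᵢⱼ : Bᵢ ↪ᵢ ¬d(rᵢ, rⱼ)` -/
noncomputable def R1 (ri rj : Rule U L) : Rule (PropSym U L) (TLabel U L) :=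
  ⟨.R1 ri rj, oldBody ri.body, ri.arrow, neg (.defeatedBy ri rj)⟩

/-- `R2ᵢⱼ : Bⱼ ⇒ d(rᵢ, rⱼ)` -/
noncomputable def R2 (ri rj : Rule U L) : Rule (PropSym U L) (TLabel U L) :=
  ⟨.R2 ri rj, oldBody rj.body, .defeasible, pos (.defeatedBy ri rj)⟩

/-- `R3ᵢⱼ : strict(q) ⇒ d(rᵢ, rⱼ)`, where `q` is the head of `rⱼ` -/
noncomputable def R3 (ri rj : Rule U L) : Rule (PropSym U L) (TLabel U L) :=
  ⟨.R3 ri rj, {pos (.strict rj.head)}, .defeasible, pos (.defeatedBy ri rj)⟩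

/-- `d(rᵢ, rⱼ) ⇒ d(rᵢ)` -/
noncomputable def viaDefeat (ri rj : Rule U L) : Rule (PropSym U L) (TLabel U L) :=
  ⟨.viaDefeat ri rj, {pos (.defeatedBy ri rj)}, .defeasible, pos (.defeated ri)⟩

/-- `fail(rᵢ) ⇒ d(rᵢ)` -/
noncomputable def viaFail (ri : Rule U L) : Rule (PropSym U L) (TLabel U L) :=
  ⟨.viaFail ri, {pos (.fail ri)}, .defeasible, pos (.defeated ri)⟩

/-- `NFᵢ : Bᵢ ⇒ ¬fail(rᵢ)` -/
noncomputable def NF (ri : Rule U L) : Rule (PropSym U L) (TLabel U L) :=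
  ⟨.NF ri, oldBody ri.body, .defeasible, neg (.fail ri)⟩

/-- `Fᵢ : ⇒ fail(rᵢ)` -/
noncomputable def F (ri : Rule U L) : Rule (PropSym U L) (TLabel U L) :=
  ⟨.F ri, ∅, .defeasible, pos (.fail ri)⟩

/-- `B ⇒ one(q)`, for `r = (B ↪ q)` -/
noncomputable def one (r : Rule U L) : Rule (PropSym U L) (TLabel U L) :=
  ⟨.one r, oldBody r.body, .defeasible, pos (.one r.head)⟩

/-- `one(q), d(r₁), …, d(rₖ) ⇒ q`, where `r₁, …, rₖ` are the rules for `∼q` -/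
noncomputable def main (D : Theory U L) (q : Lit U) : Rule (PropSym U L) (TLabel U L) :=
  ⟨.main q,
    insert (pos (.one q))
      ((D.rules.filter fun r => r.head = q.compl).image fun r => pos (.defeated r)),
    .defeasible, q.map .old⟩

/-- The strict rules. -/
noncomputable def strictRules (D : Theory U L) : Finset (Rule U L) :=
  D.rules.filter fun r => r.arrow = .strict

/-- The ordered pairs `(rᵢ, rⱼ)` of opposing rules such that `rⱼ` is not a defeater. -/
noncomputable def opposing (D : Theory U L) : Finset (Rule U L × Rule U L) :=
  (D.rules ×ˢ D.rules).filter fun x => x.1.head = x.2.head.compl ∧ x.2.arrow ≠ .defeater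

/-- The literals `q` such that `q` or `∼q` occurs in a rule. (For any other literal `q` there
would be no rule with head `one(q)`, so that the rule `main D q` could never be applied.) -/
noncomputable def ruleLits (D : Theory U L) : Finset (Lit U) :=
  let O := D.rules.biUnion fun r => insert r.head r.body
  O ∪ O.image Lit.compl

/-- The rules of the translated theory. -/
noncomputable def rules (D : Theory U L) : Finset (Rule (PropSym U L) (TLabel U L)) :=
  ((strictRules D).biUnion fun r => {ns r.head, s r, strictHead r.head}) ∪
  ((opposing D).biUnion fun x => {R1 x.1 x.2, R2 x.1 x.2, R3 x.1 x.2, viaDefeat x.1 x.2}) ∪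
  (D.rules.biUnion fun r => {viaFail r, NF r, F r}) ∪
  ((D.rules.filter fun r => r.arrow ≠ .defeater).image one) ∪
  ((ruleLits D).image (main D))

/-- The superiority relation of the translated theory: `ns(q) > s(r)`; `R2ᵢⱼ > R1ᵢⱼ` iff
`rⱼ > rᵢ`; `R3ᵢⱼ > R1ᵢⱼ`; `NFᵢ > Fᵢ`. -/
noncomputable def sup (D : Theory U L) :
    Finset (Rule (PropSym U L) (TLabel U L) × Rule (PropSym U L) (TLabel U L)) :=
  ((strictRules D).image fun r => (ns r.head, s r)) ∪
  (((opposing D).filter fun x => (x.2, x.1) ∈ D.sup).image fun x => (R2 x.1 x.2, R1 x.1 x.2)) ∪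
  ((opposing D).image fun x => (R3 x.1 x.2, R1 x.1 x.2)) ∪
  (D.rules.image fun r => (NF r, F r))

end TranslatedRules

end Translation

/-- The translated theory `T(D)`. Its language consists of the old language and of the propositions
that occur in its rules. -/
noncomputable def Theory.translate {U L : Type*} (D : Theory U L) :
    Theory (PropSym U L) (TLabel U L) where
  lang := PropSym.old '' D.lang ∪
    {p | ∃ r ∈ Translation.rules D, p = r.head.atom ∨ ∃ a ∈ r.body, p = a.atom}
  facts := Lit.map PropSym.old '' D.facts
  rules := Translation.rules D
  sup := Translation.sup D

/-! Both logics infer by least fixed points, so it suffices to match single inference steps. Call a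
literal old if its proposition comes from `D`. For a set `Y` of conclusions that is closed under
inference at the new literals, each new literal has an explicit meaning in terms of the old ones.
With these meanings inserted, one step without team defeat in the translation at an old literal
becomes one step with team defeat in `D`. `OrderHom.mem_lfp_iff_of_key` lifts such an agreement of
steps to least fixed points.

The meanings are as follows. `strict(q)` holds iff `q` follows by a strict rule, and `fail(r)` holds
iff the body of `r` is refuted. In `T(D)`, `d(s,t)` says that the rule `t` defeats `s`. The rule for
`q` therefore applies iff some rule for `q` applies and every rule for `∼q` is discarded or beaten
by some member of the team for `q`.

The delicate point is the opposing rule for `∼q`, which must be refuted whenever team defeat yields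
`q`. Here acyclicity enters (`IsDefeasible.exists_undefeated`): among the applicable rules for `q`
take a maximal one, `r`. A rule `s > r` that is not discarded would be beaten by an applicable `t >
s > r`, against maximality. So nothing defeats `r`, the literal `d(r)` is refuted, and with it the
rule for `∼q`. The negative tags are treated dually.

For `δ` a second translation is used. It removes superiority between rules for old literals by
writing it into bodies: a rule `r` becomes a defeater (`attack`) that also requires the superior
non-defeaters to fail, and, unless `r` is a defeater, a defeasible rule (`support`) that requires
all superior opponents to fail. The proposition `fail(r)` interchanges the tags: `+δ*` of `fail(r)`
speaks of `-σ*` in the body of `r`, and `+σ*` of `-δ*`. This is the exchange found in the clauses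
for `δ` and `σ`. -/

/-! ### Comparison of two least fixed points -/

/-- Here `K` is the set of relevant conclusions, and what lies outside `ω '' K` is auxiliary. The
agreement `key` is only demanded for sets that are closed at the auxiliary elements and are fixed on
`ω '' K` for one of the two operators. Both kinds are needed, one for each direction. -/
theorem OrderHom.mem_lfp_iff_of_key {α β : Type*} (f : Set α →o Set α) (g : Set β →o Set β)
    (K : Set α) (ω : α → β) (hω : Set.InjOn ω K)
    (hloc : ∀ X, ∀ c ∈ K, c ∈ f X → c ∈ f (X ∩ K))
    (key : ∀ Y : Set β, (∀ b, b ∉ ω '' K → (b ∈ Y ↔ b ∈ g Y)) →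
      ((∀ c ∈ K, ω c ∈ Y ↔ ω c ∈ g Y) ∨ (∀ c ∈ K, ω c ∈ Y ↔ c ∈ f (ω ⁻¹' Y))) →
      ∀ c ∈ K, (ω c ∈ g Y ↔ c ∈ f (ω ⁻¹' Y))) :
    ∀ c ∈ K, (c ∈ OrderHom.lfp f ↔ ω c ∈ OrderHom.lfp g) := by
  have hf := f.map_lfp
  have hg := g.map_lfp
  intro c hc
  constructor
  · have h : OrderHom.lfp f ≤ {c | c ∈ K → ω c ∈ OrderHom.lfp g} := by
      refine OrderHom.lfp_le _ fun c hc hK => ?_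
      have h1 := f.monotone (show _ ⊆ ω ⁻¹' (OrderHom.lfp g) from fun x hx => hx.1 hx.2)
        (hloc _ c hK hc)
      -- The set `lfp g` is fixed for `g` everywhere, so the first alternative of `key` applies.
      have h2 := (key (OrderHom.lfp g) (fun b _ => by rw [hg])
        (Or.inl fun b _ => by rw [hg]) c hK).2 h1
      rwa [hg] at h2
    exact fun hc' => h hc' hc
  -- `G` freezes the relevant part at the image of `lfp f` and closes only the auxiliary part under
  -- `g`. Its least fixed point `Y` satisfies the second alternative of `key`, and this makes `Y`
  -- closed under `g`.
  · let G : Set β →o Set β :=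
      ⟨fun Y => {b | (∃ c ∈ K, c ∈ OrderHom.lfp f ∧ ω c = b) ∨ (b ∉ ω '' K ∧ b ∈ g Y)},
        fun Y Y' h b hb => hb.imp_right fun hb => ⟨hb.1, g.monotone h hb.2⟩⟩
    set Y := OrderHom.lfp G with hYdef
    have hG : G Y = Y := G.map_lfp
    have hmem : ∀ b, b ∈ Y ↔ b ∈ G Y := fun b => by rw [hG]
    have hnew : ∀ b, b ∉ ω '' K → (b ∈ Y ↔ b ∈ g Y) := by
      intro b hb
      rw [hmem]
      refine ⟨fun h => h.elim (fun ⟨c, hc, _, h⟩ => (hb ⟨c, hc, h⟩).elim) And.right,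
        fun h => Or.inr ⟨hb, h⟩⟩
    have hold : ∀ c ∈ K, (ω c ∈ Y ↔ c ∈ OrderHom.lfp f) := by
      intro c hc
      rw [hmem]
      refine ⟨fun h => h.elim (fun ⟨c', hc', h', e⟩ => hω hc' hc e ▸ h')
        (fun h => (h.1 ⟨c, hc, rfl⟩).elim), fun h => Or.inl ⟨c, hc, h, rfl⟩⟩
    have hfix : ∀ c ∈ K, (ω c ∈ Y ↔ c ∈ f (ω ⁻¹' Y)) := by
      intro c hc
      rw [hold c hc]
      constructor
      · intro h
        rw [← hf] at h
        exact f.monotone (fun x hx => (hold x hx.2).2 hx.1) (hloc _ c hc h)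
      · intro h
        rw [← hf]
        exact f.monotone (fun x hx => (hold x hx.2).1 hx.1) (hloc _ c hc h)
    have hle : OrderHom.lfp g ≤ Y := by
      refine OrderHom.lfp_le _ fun b hb => ?_
      by_cases h : b ∈ ω '' K
      · obtain ⟨c, hc, rfl⟩ := h
        exact (hfix c hc).2 ((key Y hnew (Or.inr hfix) c hc).1 hb)
      · exact (hnew b h).2 hb
    exact fun h => (hold c hc).1 (hle h)

/-! ### Renaming of literals, conclusions and theories -/

theorem Lit.map_injective {U V : Type*} {f : U → V} (hf : Function.Injective f) :
    Function.Injective (Lit.map f) := by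
  rintro (a | a) (b | b) h <;> simp_all [Lit.map, hf.eq_iff]

@[simp] theorem Lit.compl_compl {U : Type*} (q : Lit U) : q.compl.compl = q := by
  cases q <;> rfl

@[simp] theorem Lit.atom_compl {U : Type*} (q : Lit U) : q.compl.atom = q.atom := by
  cases q <;> rfl

@[simp] theorem Lit.atom_map {U V : Type*} (f : U → V) (q : Lit U) :
    (q.map f).atom = f q.atom := by
  cases q <;> rfl

theorem Lit.map_compl {U V : Type*} (f : U → V) (q : Lit U) :
    (q.map f).compl = q.compl.map f := by
  cases q <;> rfl

namespace Conclusion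

/-- The tag of a conclusion. -/
def tag {U : Type*} : Conclusion U → Tag
  | plus d _ => d
  | minus d _ => d

/-- Translation of conclusions along a map of tags and a map of propositions. -/
def map {U V : Type*} (τ : Tag → Tag) (f : U → V) : Conclusion U → Conclusion V
  | plus d q => plus (τ d) (q.map f)
  | minus d q => minus (τ d) (q.map f)

theorem map_injOn {U V : Type*} {τ : Tag → Tag} {f : U → V} {S : Set Tag} (hτ : Set.InjOn τ S)
    (hf : Function.Injective f) : Set.InjOn (map τ f) {c : Conclusion U | c.tag ∈ S} := by
  rintro (⟨d, q⟩ | ⟨d, q⟩) h (⟨d', q'⟩ | ⟨d', q'⟩) h' e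
  · simp only [map, plus.injEq] at e
    rw [show d = d' from hτ h h' e.1, Lit.map_injective hf e.2]
  · simp [map] at e
  · simp [map] at e
  · simp only [map, minus.injEq] at e
    rw [show d = d' from hτ h h' e.1, Lit.map_injective hf e.2]

end Conclusion

/-- The tag without team defeat that corresponds to a tag with team defeat. -/
def Tag.star : Tag → Tag
  | .partial_ => .partialStar
  | .delta => .deltaStar
  | .sigma => .sigmaStar
  | d => d

namespace Theory

open Conclusion

section Map

variable {U V L : Type*}

open Classical in
/-- The rule, with the propositions read as elements of a larger stock. -/
noncomputable def mapRule (ι : U ↪ V) (r : Rule U L) : Rule V L :=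
  ⟨r.label, r.body.image (Lit.map ι), r.arrow, r.head.map ι⟩

theorem mapRule_injective (ι : U ↪ V) : Function.Injective (mapRule ι : Rule U L → Rule V L) := by
  classical
  rintro ⟨l, b, a, h⟩ ⟨l', b', a', h'⟩ e
  simp only [mapRule, Rule.mk.injEq] at e
  obtain ⟨rfl, e2, rfl, e4⟩ := e
  rw [Lit.map_injective ι.injective e4,
    Finset.image_injective (Lit.map_injective ι.injective) e2]

variable (D : Theory U L) (ι : U ↪ V) (A : Set (Lit V))

theorem R_map (q : Lit U) :
    ((D.map ι).addFacts A).R (q.map ι) = mapRule ι '' D.R q := by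
  classical
  ext r
  simp only [R, addFacts, Theory.map, Set.mem_ofPred_eq, Finset.mem_image, Set.mem_image]
  constructor
  · rintro ⟨⟨r, hr, rfl⟩, h⟩
    exact ⟨r, ⟨hr, Lit.map_injective ι.injective h⟩, rfl⟩
  · rintro ⟨r, ⟨hr, rfl⟩, rfl⟩
    exact ⟨⟨r, hr, rfl⟩, rfl⟩

theorem Rs_map (q : Lit U) :
    ((D.map ι).addFacts A).Rs (q.map ι) = mapRule ι '' D.Rs q := by
  ext r
  simp only [Rs, R_map, Set.mem_ofPred_eq, Set.mem_image]
  constructor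
  · rintro ⟨⟨r, hr, rfl⟩, h⟩
    exact ⟨r, ⟨hr, h⟩, rfl⟩
  · rintro ⟨r, ⟨hr, h⟩, rfl⟩
    exact ⟨⟨r, hr, rfl⟩, h⟩

theorem Rsd_map (q : Lit U) :
    ((D.map ι).addFacts A).Rsd (q.map ι) = mapRule ι '' D.Rsd q := by
  ext r
  simp only [Rsd, R_map, Set.mem_ofPred_eq, Set.mem_image]
  constructor
  · rintro ⟨⟨r, hr, rfl⟩, h⟩
    exact ⟨r, ⟨hr, h⟩, rfl⟩
  · rintro ⟨r, ⟨hr, h⟩, rfl⟩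
    exact ⟨⟨r, hr, rfl⟩, h⟩

theorem mem_facts_map (q : Lit U) :
    q.map ι ∈ ((D.map ι).addFacts A).facts ↔ q ∈ (D.addFacts (Lit.map ι ⁻¹' A)).facts := by
  simp [addFacts, Theory.map, (Lit.map_injective ι.injective).eq_iff]

theorem mem_sup_map (r s : Rule U L) :
    (mapRule ι r, mapRule ι s) ∈ ((D.map ι).addFacts A).sup ↔ (r, s) ∈ D.sup := by
  classical
  simp only [addFacts, Theory.map, Finset.mem_image, Prod.exists, Prod.map_apply, Prod.mk.injEq]
  constructor
  · rintro ⟨a, b, h, e1, e2⟩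
    rwa [← mapRule_injective ι e1, ← mapRule_injective ι e2]
  · exact fun h => ⟨r, s, h, rfl, rfl⟩

theorem forall_mem_mapRule (r : Rule U L) (P : Lit V → Prop) :
    (∀ a ∈ (mapRule ι r).body, P a) ↔ ∀ a ∈ r.body, P (a.map ι) := by
  classical
  exact Finset.forall_mem_image

theorem exists_mem_mapRule (r : Rule U L) (P : Lit V → Prop) :
    (∃ a ∈ (mapRule ι r).body, P a) ↔ ∃ a ∈ r.body, P (a.map ι) := by
  classical
  exact Finset.exists_mem_image

theorem infers_map (E : Set (Conclusion V)) (c : Conclusion U) :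
    ((D.map ι).addFacts A).Infers E (c.map id ι) ↔
      (D.addFacts (Lit.map ι ⁻¹' A)).Infers (Conclusion.map id ι ⁻¹' E) c := by
  rcases c with ⟨d, q⟩ | ⟨d, q⟩ <;> cases d <;>
    simp only [Infers, PlusDelta, MinusDelta, PlusTeam, MinusTeam, PlusSingle, MinusSingle,
      PlusSupport, MinusSupport, Conclusion.map, id, Set.mem_preimage, Lit.map_compl, R_map,
      Rs_map, Rsd_map, mem_facts_map, Set.forall_mem_image, Set.exists_mem_image,
      forall_mem_mapRule, exists_mem_mapRule, mem_sup_map] <;> rfl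

/-- Inference at a renamed literal consults renamed literals only, so the added facts about
propositions outside the range of `ι` drop out. -/
theorem proves_map (c : Conclusion U) :
    ((D.map ι).addFacts A).Proves (c.map id ι) ↔
      (D.addFacts (Lit.map ι ⁻¹' A)).Proves c := by
  refine (OrderHom.mem_lfp_iff_of_key (D.addFacts (Lit.map ι ⁻¹' A)).step
    ((D.map ι).addFacts A).step Set.univ (Conclusion.map id ι) ?_ ?_ ?_ c trivial).symm
  · intro c _ c' _ h
    exact map_injOn (Set.injOn_id Set.univ) ι.injective (Set.mem_univ _) (Set.mem_univ _) h
  · intro X c _ h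
    simpa using h
  · exact fun Y _ _ c _ => infers_map D ι A Y c

end Map

/-- Acyclicity makes the transitive closure of `>` a strict order, which is well-founded on the
finite set of rules. Its left argument is the superior one, so a minimal element is a maximally
superior rule. -/
theorem IsDefeasible.exists_maximal {U L : Type*} {D : Theory U L} (h : D.IsDefeasible)
    (P : Rule U L → Prop) (hP : ∃ r ∈ D.rules, P r) :
    ∃ r ∈ D.rules, P r ∧
      ∀ t ∈ D.rules, P t → ¬ Relation.TransGen (fun s t => (s, t) ∈ D.sup) t r := by
  let rel : Rule U L → Rule U L → Prop := Relation.TransGen fun s t => (s, t) ∈ D.sup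
  have : IsStrictOrder (Rule U L) rel :=
    { irrefl := h.acyclic, trans := fun _ _ _ h h' => h.trans h' }
  have hwf := (D.rules.finite_toSet).wellFoundedOn (r := rel)
  obtain ⟨r, hr, hPr⟩ := hP
  obtain ⟨⟨m, hm⟩, hPm, hmin⟩ :=
    hwf.has_min {x : {x // x ∈ (D.rules : Set (Rule U L))} | P x.1} ⟨⟨r, hr⟩, hPr⟩
  exact ⟨m, hm, hPm, fun t ht hPt hlt => hmin ⟨t, ht⟩ hPt hlt⟩

/-- This is the locality hypothesis of the fixed point comparison: the clauses for `Δ` and `∂`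
consult no other tags. -/
theorem infers_inter_partial {U L : Type*} (D : Theory U L) (X : Set (Conclusion U))
    (c : Conclusion U) (hc : c.tag ∈ ({.Delta, .partial_} : Set Tag)) (h : D.Infers X c) :
    D.Infers (X ∩ {c | c.tag ∈ ({.Delta, .partial_} : Set Tag)}) c := by
  rcases c with ⟨d, q⟩ | ⟨d, q⟩ <;> cases d <;> simp [Conclusion.tag] at hc <;>
    simpa [Infers, PlusDelta, MinusDelta, PlusTeam, MinusTeam, Conclusion.tag] using h

theorem infers_inter_delta {U L : Type*} (D : Theory U L) (X : Set (Conclusion U))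
    (c : Conclusion U) (hc : c.tag ∈ ({.Delta, .delta, .sigma} : Set Tag)) (h : D.Infers X c) :
    D.Infers (X ∩ {c | c.tag ∈ ({.Delta, .delta, .sigma} : Set Tag)}) c := by
  rcases c with ⟨d, q⟩ | ⟨d, q⟩ <;> cases d <;> simp [Conclusion.tag] at hc <;>
    simpa [Infers, PlusDelta, MinusDelta, PlusTeam, MinusTeam, PlusSupport, MinusSupport,
      Conclusion.tag] using h

end Theory

/-! ### The gadgets for `strict(q)` and `fail(r)` -/

namespace Translation

open Theory Conclusion

variable {U L : Type*}

theorem forall_mem_oldBody (B : Finset (Lit U)) (P : Lit (PropSym U L) → Prop) :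
    (∀ a ∈ oldBody B, P a) ↔ ∀ a ∈ B, P (a.map .old) := by
  classical
  exact Finset.forall_mem_image

theorem exists_mem_oldBody (B : Finset (Lit U)) (P : Lit (PropSym U L) → Prop) :
    (∃ a ∈ oldBody B, P a) ↔ ∃ a ∈ B, P (a.map .old) := by
  classical
  exact Finset.exists_mem_image

@[simp] theorem forall_mem_s (r : Rule U L) (P : Lit (PropSym U L) → Prop) :
    (∀ a ∈ (s r).body, P a) ↔ ∀ a ∈ r.body, P (a.map .old) := forall_mem_oldBody _ _

@[simp] theorem exists_mem_s (r : Rule U L) (P : Lit (PropSym U L) → Prop) :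
    (∃ a ∈ (s r).body, P a) ↔ ∃ a ∈ r.body, P (a.map .old) := exists_mem_oldBody _ _

@[simp] theorem forall_mem_NF (r : Rule U L) (P : Lit (PropSym U L) → Prop) :
    (∀ a ∈ (NF r).body, P a) ↔ ∀ a ∈ r.body, P (a.map .old) := forall_mem_oldBody _ _

@[simp] theorem exists_mem_NF (r : Rule U L) (P : Lit (PropSym U L) → Prop) :
    (∃ a ∈ (NF r).body, P a) ↔ ∃ a ∈ r.body, P (a.map .old) := exists_mem_oldBody _ _

@[simp] theorem body_ns (q : Lit U) : (ns q : Rule (PropSym U L) _).body = ∅ := rfl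

@[simp] theorem body_F (r : Rule U L) : (F r).body = ∅ := rfl

@[simp] theorem body_strictHead (q : Lit U) :
    (strictHead q : Rule (PropSym U L) _).body = {.pos (.strict q)} := rfl

@[simp] theorem compl_pos {W : Type*} (p : W) : (Lit.pos p).compl = Lit.neg p := rfl

@[simp] theorem compl_neg {W : Type*} (p : W) : (Lit.neg p).compl = Lit.pos p := rfl

/-- The conclusions in `Y` about new propositions are those inferred from `Y`. -/
def FixedAtNew (Θ : Theory (PropSym U L) (TLabel U L))
    (Y : Set (Conclusion (PropSym U L))) : Prop :=
  ∀ l : Lit (PropSym U L), (∀ p, l.atom ≠ .old p) → ∀ d,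
    (plus d l ∈ Y ↔ Θ.Infers Y (plus d l)) ∧ (minus d l ∈ Y ↔ Θ.Infers Y (minus d l))

/-- The rules of `Θ` for the proposition `strict(q)` are those of the translation. -/
structure HasStrict (D : Theory U L) (Θ : Theory (PropSym U L) (TLabel U L)) (q : Lit U) :
    Prop where
  pos_notMem : Lit.pos (.strict q) ∉ Θ.facts
  R_pos : ∀ P : Rule (PropSym U L) (TLabel U L) → Prop,
    (∃ r ∈ Θ.R (.pos (.strict q)), P r) ↔ ∃ r ∈ D.Rs q, P (s r)
  R_neg : ∀ r ∈ D.Rs q, ns q ∈ Θ.R (.neg (.strict q))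
  sup : ∀ r, (s r, ns q) ∉ Θ.sup
  sup' : ∀ r ∈ D.Rs q, (ns q, s r) ∈ Θ.sup

/-- The rules of `Θ` for the proposition `fail(r)` are those of the translation. -/
structure HasFail (Θ : Theory (PropSym U L) (TLabel U L)) (r : Rule U L) : Prop where
  pos_notMem : Lit.pos (.fail r) ∉ Θ.facts
  neg_notMem : Lit.neg (.fail r) ∉ Θ.facts
  R_pos : Θ.R (.pos (.fail r)) = {F r}
  R_neg : Θ.R (.neg (.fail r)) = {NF r}
  sup : (F r, NF r) ∉ Θ.sup
  sup' : (NF r, F r) ∈ Θ.sup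

section Gadgets

variable {D : Theory U L} {Θ : Theory (PropSym U L) (TLabel U L)}
  {Y : Set (Conclusion (PropSym U L))} {q : Lit U}

theorem HasStrict.exists_Rs (h : HasStrict D Θ q) (P : Rule (PropSym U L) (TLabel U L) → Prop) :
    (∃ r ∈ Θ.Rs (.pos (.strict q)), P r) ↔ ∃ r ∈ D.Rs q, P (s r) := by
  have := h.R_pos fun r => r.arrow = .strict ∧ P r
  simpa [Rs, and_assoc, s] using this

theorem HasStrict.exists_Rsd (h : HasStrict D Θ q) (P : Rule (PropSym U L) (TLabel U L) → Prop) :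
    (∃ r ∈ Θ.Rsd (.pos (.strict q)), P r) ↔ ∃ r ∈ D.Rs q, P (s r) := by
  have := h.R_pos fun r => r.arrow ≠ .defeater ∧ P r
  simpa [Rsd, and_assoc, s] using this

theorem HasStrict.forall_Rs (h : HasStrict D Θ q) (P : Rule (PropSym U L) (TLabel U L) → Prop) :
    (∀ r ∈ Θ.Rs (.pos (.strict q)), P r) ↔ ∀ r ∈ D.Rs q, P (s r) := by
  have := h.exists_Rs fun r => ¬ P r
  grind

theorem HasStrict.forall_Rsd (h : HasStrict D Θ q) (P : Rule (PropSym U L) (TLabel U L) → Prop) :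
    (∀ r ∈ Θ.Rsd (.pos (.strict q)), P r) ↔ ∀ r ∈ D.Rs q, P (s r) := by
  have := h.exists_Rsd fun r => ¬ P r
  grind

/-- The rules `s(r)` copy the strict rules for `q` but not the facts, so `strict(q)` records
derivability by a strict rule only. -/
theorem HasStrict.plus_Delta (h : HasStrict D Θ q) (hY : FixedAtNew Θ Y) :
    plus .Delta (.pos (.strict q)) ∈ Y ↔
      ∃ r ∈ D.Rs q, ∀ a ∈ r.body, plus .Delta (a.map .old) ∈ Y := by
  rw [(hY _ (by simp [Lit.atom]) _).1]
  simp only [Infers, PlusDelta, h.exists_Rs, h.pos_notMem, false_or, forall_mem_s]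

theorem HasStrict.minus_Delta (h : HasStrict D Θ q) (hY : FixedAtNew Θ Y) :
    minus .Delta (.pos (.strict q)) ∈ Y ↔
      ∀ r ∈ D.Rs q, ∃ a ∈ r.body, minus .Delta (a.map .old) ∈ Y := by
  rw [(hY _ (by simp [Lit.atom]) _).2]
  simp only [Infers, MinusDelta, h.forall_Rs, h.pos_notMem, not_false_eq_true, true_and,
    exists_mem_s]

/-- The opponent `ns q` has an empty body and no `s r` is superior to it, so it blocks every
defeasible use of the rules `s r`. Only strict derivation is left. -/
theorem HasStrict.plusSingle (h : HasStrict D Θ q) {d c : Tag} :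
    Θ.PlusSingle Y d c (.pos (.strict q)) ↔ plus .Delta (.pos (.strict q)) ∈ Y := by
  simp only [PlusSingle, h.exists_Rsd, or_iff_left_iff_imp]
  rintro ⟨r, hr, -, -, h3⟩
  simpa [h.sup] using h3 _ (h.R_neg r hr)

theorem HasStrict.minusSingle (h : HasStrict D Θ q) {d c : Tag} :
    Θ.MinusSingle Y d c (.pos (.strict q)) ↔ minus .Delta (.pos (.strict q)) ∈ Y := by
  simp only [MinusSingle, h.forall_Rsd, and_iff_left_iff_imp]
  exact fun _ r hr => Or.inr (Or.inr ⟨_, h.R_neg r hr, by simp, h.sup r⟩)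

/-- For support an opponent counts only if it is superior. This is the purpose of `ns q` being
superior to `s r`. -/
theorem HasStrict.plusSupport (h : HasStrict D Θ q) {d c : Tag} :
    Θ.PlusSupport Y d c (.pos (.strict q)) ↔ plus .Delta (.pos (.strict q)) ∈ Y := by
  simp only [PlusSupport, h.exists_Rsd, or_iff_left_iff_imp]
  rintro ⟨r, hr, -, h3⟩
  simpa [h.sup' r hr] using h3 _ (h.R_neg r hr)

theorem HasStrict.minusSupport (h : HasStrict D Θ q) {d c : Tag} :
    Θ.MinusSupport Y d c (.pos (.strict q)) ↔ minus .Delta (.pos (.strict q)) ∈ Y := by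
  simp only [MinusSupport, h.forall_Rsd, and_iff_left_iff_imp]
  exact fun _ r hr => Or.inr ⟨_, h.R_neg r hr, by simp, h.sup' r hr⟩

section Fail

variable {r : Rule U L}

theorem HasFail.Rs_pos (h : HasFail Θ r) : Θ.Rs (.pos (.fail r)) = ∅ := by
  ext x
  simp only [Rs, h.R_pos, Set.mem_singleton_iff, Set.mem_ofPred_eq, Set.mem_empty_iff_false,
    iff_false]
  rintro ⟨rfl, h⟩
  simp [F] at h

theorem HasFail.Rs_neg (h : HasFail Θ r) : Θ.Rs (.neg (.fail r)) = ∅ := by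
  ext x
  simp only [Rs, h.R_neg, Set.mem_singleton_iff, Set.mem_ofPred_eq, Set.mem_empty_iff_false,
    iff_false]
  rintro ⟨rfl, h⟩
  simp [NF] at h

theorem HasFail.Rsd_pos (h : HasFail Θ r) : Θ.Rsd (.pos (.fail r)) = {F r} := by
  ext x
  simp only [Rsd, h.R_pos, Set.mem_singleton_iff, Set.mem_ofPred_eq, and_iff_left_iff_imp]
  rintro rfl
  simp [F]

variable (h : HasFail Θ r) (hY : FixedAtNew Θ Y)
include h hY

theorem HasFail.plus_Delta : plus .Delta (.pos (.fail r)) ∉ Y := by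
  rw [(hY _ (by simp [Lit.atom]) _).1]
  simp [Infers, PlusDelta, h.Rs_pos, h.pos_notMem]

theorem HasFail.minus_Delta : minus .Delta (.pos (.fail r)) ∈ Y := by
  rw [(hY _ (by simp [Lit.atom]) _).2]
  simp [Infers, MinusDelta, h.Rs_pos, h.pos_notMem]

theorem HasFail.plus_Delta_neg : plus .Delta (.neg (.fail r)) ∉ Y := by
  rw [(hY _ (by simp [Lit.atom]) _).1]
  simp [Infers, PlusDelta, h.Rs_neg, h.neg_notMem]

theorem HasFail.minus_Delta_neg : minus .Delta (.neg (.fail r)) ∈ Y := by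
  rw [(hY _ (by simp [Lit.atom]) _).2]
  simp [Infers, MinusDelta, h.Rs_neg, h.neg_notMem]

/-- `F r` has an empty body and does not beat its only opponent `NF r`. Hence everything depends on
the body of `NF r`, which is evaluated under the tag `c` for opponents. -/
theorem HasFail.plusSingle {d c : Tag} :
    Θ.PlusSingle Y d c (.pos (.fail r)) ↔ ∃ a ∈ r.body, minus c (a.map .old) ∈ Y := by
  simp [PlusSingle, h.Rsd_pos, h.R_neg, h.plus_Delta hY, h.minus_Delta_neg hY, h.sup]

theorem HasFail.minusSingle {d c : Tag} :
    Θ.MinusSingle Y d c (.pos (.fail r)) ↔ ∀ a ∈ r.body, plus c (a.map .old) ∈ Y := by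
  simp [MinusSingle, h.Rsd_pos, h.R_neg, h.minus_Delta hY, h.plus_Delta_neg hY, h.sup]

/-- Since `NF r` is superior to `F r`, it counts as an opponent for support as well, and its body is
now evaluated under the main tag `d`. Thus `fail(r)` interchanges `d` and `c`. -/
theorem HasFail.plusSupport {d c : Tag} :
    Θ.PlusSupport Y d c (.pos (.fail r)) ↔ ∃ a ∈ r.body, minus d (a.map .old) ∈ Y := by
  simp [PlusSupport, h.Rsd_pos, h.R_neg, h.plus_Delta hY, h.sup']

theorem HasFail.minusSupport {d c : Tag} :
    Θ.MinusSupport Y d c (.pos (.fail r)) ↔ ∀ a ∈ r.body, plus d (a.map .old) ∈ Y := by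
  simp [MinusSupport, h.Rsd_pos, h.R_neg, h.minus_Delta hY, h.sup']

end Fail

end Gadgets

end Translation

/-! ### Strict conclusions about old literals -/

namespace Translation

open Theory Conclusion

variable {U L : Type*}

/-- The strict rules of `Θ` for the old literal `q`, and those for `strict(q)`, are the ones of the
translation, and `Θ` has the same old facts as `D + A`. -/
structure HasOld (D : Theory U L) (A : Set (Lit U)) (Θ : Theory (PropSym U L) (TLabel U L)) :
    Prop where
  facts : ∀ q : Lit U, q.map .old ∈ Θ.facts ↔ q ∈ D.facts ∪ A
  Rs : ∀ (q : Lit U) r, r ∈ Θ.Rs (q.map .old) ↔ r = strictHead q ∧ (D.Rs q).Nonempty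
  hasStrict : ∀ q, (D.Rs q).Nonempty → HasStrict D Θ q

section Delta

variable {D : Theory U L} {A : Set (Lit U)} {Θ : Theory (PropSym U L) (TLabel U L)}
  {Y : Set (Conclusion (PropSym U L))} (h : HasOld D A Θ) (hY : FixedAtNew Θ Y)
include h hY

/-- The only strict rule for the old literal is `strictHead q`, through which all strict rules of
`D` for `q` are factored. -/
theorem HasOld.plusDelta (q : Lit U) : Θ.PlusDelta Y (q.map .old) ↔
    (D.addFacts A).PlusDelta (Conclusion.map Tag.star .old ⁻¹' Y) q := by
  have e : (∃ r ∈ Θ.Rs (q.map .old), ∀ a ∈ r.body, plus .Delta a ∈ Y) ↔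
      ∃ r ∈ D.Rs q, ∀ a ∈ r.body, plus .Delta (a.map .old) ∈ Y := by
    simp only [h.Rs]
    constructor
    · rintro ⟨_, ⟨rfl, hne⟩, hr⟩
      exact ((h.hasStrict q hne).plus_Delta hY).1 (hr _ (by simp))
    · intro hr
      have hne : (D.Rs q).Nonempty := let ⟨r, hr, _⟩ := hr; ⟨r, hr⟩
      refine ⟨_, ⟨rfl, hne⟩, ?_⟩
      simpa using ((h.hasStrict q hne).plus_Delta hY).2 hr
  exact or_congr (h.facts q) e

theorem HasOld.minusDelta (q : Lit U) : Θ.MinusDelta Y (q.map .old) ↔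
    (D.addFacts A).MinusDelta (Conclusion.map Tag.star .old ⁻¹' Y) q := by
  have e : (∀ r ∈ Θ.Rs (q.map .old), ∃ a ∈ r.body, minus .Delta a ∈ Y) ↔
      ∀ r ∈ D.Rs q, ∃ a ∈ r.body, minus .Delta (a.map .old) ∈ Y := by
    simp only [h.Rs]
    constructor
    · intro hr r hr'
      refine ((h.hasStrict q ⟨r, hr'⟩).minus_Delta hY).1 ?_ r hr'
      simpa using hr _ ⟨rfl, ⟨r, hr'⟩⟩
    · rintro hr _ ⟨rfl, hne⟩
      simpa using ((h.hasStrict q hne).minus_Delta hY).2 hr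
  exact and_congr (not_congr (h.facts q)) e

end Delta

/-! ### The rules and the superiority relation of `T(D)`, sorted by head -/

section Translate

variable (D : Theory U L) (A : Set (Lit (PropSym U L)))

theorem forall_mem_main (q : Lit U) (P : Lit (PropSym U L) → Prop) :
    (∀ a ∈ (main D q).body, P a) ↔
      P (.pos (.one q)) ∧ ∀ r ∈ D.R q.compl, P (.pos (.defeated r)) := by
  simp only [main, R, Finset.forall_mem_insert, Finset.forall_mem_image, Finset.mem_filter]
  rfl

theorem exists_mem_main (q : Lit U) (P : Lit (PropSym U L) → Prop) :
    (∃ a ∈ (main D q).body, P a) ↔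
      P (.pos (.one q)) ∨ ∃ r ∈ D.R q.compl, P (.pos (.defeated r)) := by
  simp [main, R]

theorem pos_eq_map_old {W : Type*} {f : U → W} {p : W} (q : Lit U) (hp : ∀ x, p ≠ f x) :
    Lit.pos p ≠ q.map f := by
  cases q <;> simp [Lit.map, hp]

theorem neg_eq_map_old {W : Type*} {f : U → W} {p : W} (q : Lit U) (hp : ∀ x, p ≠ f x) :
    Lit.neg p ≠ q.map f := by
  cases q <;> simp [Lit.map, hp]

theorem map_old_inj (q q' : Lit U) :
    q.map (PropSym.old (L := L)) = q'.map .old ↔ q = q' :=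
  (Lit.map_injective (PropSym.oldEmb U L).injective).eq_iff

theorem mem_rules (r : Rule (PropSym U L) (TLabel U L)) :
    r ∈ rules D ↔
      ((((∃ x ∈ strictRules D, r = ns x.head ∨ r = s x ∨ r = strictHead x.head) ∨
        (∃ x ∈ opposing D,
          r = R1 x.1 x.2 ∨ r = R2 x.1 x.2 ∨ r = R3 x.1 x.2 ∨ r = viaDefeat x.1 x.2)) ∨
        (∃ x ∈ D.rules, r = viaFail x ∨ r = NF x ∨ r = F x)) ∨
        (∃ x, (x ∈ D.rules ∧ x.arrow ≠ .defeater) ∧ one x = r)) ∨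
        (∃ q ∈ ruleLits D, main D q = r) := by
  simp only [rules, Finset.mem_union, Finset.mem_biUnion, Finset.mem_insert,
    Finset.mem_singleton, Finset.mem_image, Finset.mem_filter]

theorem mem_R_old (q : Lit U) (r : Rule (PropSym U L) (TLabel U L)) :
    r ∈ (D.translate.addFacts A).R (q.map .old) ↔
      (r = strictHead q ∧ (D.Rs q).Nonempty) ∨ (r = main D q ∧ q ∈ ruleLits D) := by
  change r ∈ rules D ∧ r.head = q.map .old ↔ _
  simp only [mem_rules, strictRules, Finset.mem_filter, Set.Nonempty, Rs, R, Set.mem_ofPred_eq]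
  constructor
  · rintro ⟨((((⟨r, hr, rfl | rfl | rfl⟩ | ⟨r, hr, rfl | rfl | rfl | rfl⟩) |
      ⟨r, hr, rfl | rfl | rfl⟩) | ⟨r, hr, rfl⟩) | ⟨q', hq, rfl⟩), h⟩ <;>
      simp only [ns, s, strictHead, R1, R2, R3, viaDefeat, viaFail, NF, F, one, main, map_old_inj]
        at h <;> first
      | exact absurd h (pos_eq_map_old q (by simp))
      | exact absurd h (neg_eq_map_old q (by simp))
      | skip
    · subst h
      exact Or.inl ⟨rfl, r, ⟨hr.1, rfl⟩, hr.2⟩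
    · subst h
      exact Or.inr ⟨rfl, hq⟩
  · rintro (⟨rfl, r, ⟨hr, rfl⟩, hr'⟩ | ⟨rfl, hq⟩)
    · exact ⟨Or.inl (Or.inl (Or.inl (Or.inl ⟨r, ⟨hr, hr'⟩, Or.inr (Or.inr rfl)⟩))), rfl⟩
    · exact ⟨Or.inr ⟨q, hq, rfl⟩, rfl⟩

/-- Membership in the rules of the translation whose head is a new literal. -/
theorem mem_R_iff (l : Lit (PropSym U L)) (r : Rule (PropSym U L) (TLabel U L)) :
    r ∈ (D.translate.addFacts A).R l ↔ r ∈ rules D ∧ r.head = l := Iff.rfl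

theorem mem_R_strict_pos (q : Lit U) (r : Rule (PropSym U L) (TLabel U L)) :
    r ∈ (D.translate.addFacts A).R (.pos (.strict q)) ↔ ∃ r' ∈ D.Rs q, r = s r' := by
  -- New literals differ from old ones; with this `simp` discards every family of rules whose head
  -- does not match.
  have h := fun q' : Lit U => (pos_eq_map_old (p := .strict q) (f := PropSym.old (L := L)) q'
    (by simp)).symm
  rw [mem_R_iff, mem_rules]
  simp only [Set.mem_ofPred_eq, Rs, R, strictRules, Finset.mem_filter]
  constructor
  · rintro ⟨((((⟨r, hr, rfl | rfl | rfl⟩ | ⟨r, hr, rfl | rfl | rfl | rfl⟩) |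
      ⟨r, hr, rfl | rfl | rfl⟩) | ⟨r, hr, rfl⟩) | ⟨q', hq, rfl⟩), e⟩ <;>
      simp [ns, s, strictHead, R1, R2, R3, viaDefeat, viaFail, NF, F, one, main, h] at e
    exact ⟨r, ⟨⟨hr.1, e⟩, hr.2⟩, rfl⟩
  · rintro ⟨r, ⟨⟨hr, rfl⟩, hr'⟩, rfl⟩
    exact ⟨Or.inl (Or.inl (Or.inl (Or.inl ⟨r, ⟨hr, hr'⟩, Or.inr (Or.inl rfl)⟩))), rfl⟩

theorem mem_R_strict_neg (q : Lit U) (h : (D.Rs q).Nonempty) :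
    ns q ∈ (D.translate.addFacts A).R (.neg (.strict q)) := by
  obtain ⟨r, ⟨hr, rfl⟩, hr'⟩ := h
  rw [mem_R_iff, mem_rules]
  simp only [strictRules, Finset.mem_filter]
  exact ⟨Or.inl (Or.inl (Or.inl (Or.inl ⟨r, ⟨hr, hr'⟩, Or.inl rfl⟩))), rfl⟩

theorem mem_R_fail_pos (r₀ : Rule U L) (r : Rule (PropSym U L) (TLabel U L)) :
    r ∈ (D.translate.addFacts A).R (.pos (.fail r₀)) ↔ r₀ ∈ D.rules ∧ r = F r₀ := by
  have h := fun q' : Lit U => (pos_eq_map_old (p := .fail r₀) (f := PropSym.old (L := L)) q'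
    (by simp)).symm
  rw [mem_R_iff, mem_rules]
  constructor
  · rintro ⟨((((⟨r, hr, rfl | rfl | rfl⟩ | ⟨r, hr, rfl | rfl | rfl | rfl⟩) |
      ⟨r, hr, rfl | rfl | rfl⟩) | ⟨r, hr, rfl⟩) | ⟨q', hq, rfl⟩), e⟩ <;>
      simp [ns, s, strictHead, R1, R2, R3, viaDefeat, viaFail, NF, F, one, main, h] at e
    subst e
    exact ⟨hr, rfl⟩
  · rintro ⟨hr, rfl⟩
    exact ⟨Or.inl (Or.inl (Or.inr ⟨_, hr, Or.inr (Or.inr rfl)⟩)), rfl⟩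

theorem mem_R_fail_neg (r₀ : Rule U L) (r : Rule (PropSym U L) (TLabel U L)) :
    r ∈ (D.translate.addFacts A).R (.neg (.fail r₀)) ↔ r₀ ∈ D.rules ∧ r = NF r₀ := by
  have h := fun q' : Lit U => (neg_eq_map_old (p := .fail r₀) (f := PropSym.old (L := L)) q'
    (by simp)).symm
  rw [mem_R_iff, mem_rules]
  constructor
  · rintro ⟨((((⟨r, hr, rfl | rfl | rfl⟩ | ⟨r, hr, rfl | rfl | rfl | rfl⟩) |
      ⟨r, hr, rfl | rfl | rfl⟩) | ⟨r, hr, rfl⟩) | ⟨q', hq, rfl⟩), e⟩ <;>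
      simp [ns, s, strictHead, R1, R2, R3, viaDefeat, viaFail, NF, F, one, main, h] at e
    subst e
    exact ⟨hr, rfl⟩
  · rintro ⟨hr, rfl⟩
    exact ⟨Or.inl (Or.inl (Or.inr ⟨_, hr, Or.inr (Or.inl rfl)⟩)), rfl⟩

theorem mem_R_one_pos (q : Lit U) (r : Rule (PropSym U L) (TLabel U L)) :
    r ∈ (D.translate.addFacts A).R (.pos (.one q)) ↔ ∃ r' ∈ D.Rsd q, r = one r' := by
  have h := fun q' : Lit U => (pos_eq_map_old (p := .one q) (f := PropSym.old (L := L)) q'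
    (by simp)).symm
  rw [mem_R_iff, mem_rules]
  simp only [Set.mem_ofPred_eq, Rsd, R]
  constructor
  · rintro ⟨((((⟨r, hr, rfl | rfl | rfl⟩ | ⟨r, hr, rfl | rfl | rfl | rfl⟩) |
      ⟨r, hr, rfl | rfl | rfl⟩) | ⟨r, hr, rfl⟩) | ⟨q', hq, rfl⟩), e⟩ <;>
      simp [ns, s, strictHead, R1, R2, R3, viaDefeat, viaFail, NF, F, one, main, h] at e
    exact ⟨r, ⟨⟨hr.1, e⟩, hr.2⟩, rfl⟩
  · rintro ⟨r, ⟨⟨hr, rfl⟩, hr'⟩, rfl⟩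
    exact ⟨Or.inl (Or.inr ⟨r, ⟨hr, hr'⟩, rfl⟩), rfl⟩

theorem R_one_neg (q : Lit U) : (D.translate.addFacts A).R (.neg (.one q)) = ∅ := by
  have h := fun q' : Lit U => (neg_eq_map_old (p := .one q) (f := PropSym.old (L := L)) q'
    (by simp)).symm
  ext r
  rw [mem_R_iff, mem_rules]
  simp only [Set.mem_empty_iff_false, iff_false]
  rintro ⟨((((⟨r, hr, rfl | rfl | rfl⟩ | ⟨r, hr, rfl | rfl | rfl | rfl⟩) |
      ⟨r, hr, rfl | rfl | rfl⟩) | ⟨r, hr, rfl⟩) | ⟨q', hq, rfl⟩), e⟩ <;>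
    simp [ns, s, strictHead, R1, R2, R3, viaDefeat, viaFail, NF, F, one, main, h] at e

theorem mem_R_defeated_pos (ri : Rule U L) (r : Rule (PropSym U L) (TLabel U L)) :
    r ∈ (D.translate.addFacts A).R (.pos (.defeated ri)) ↔
      (ri ∈ D.rules ∧ r = viaFail ri) ∨ ∃ rj, (ri, rj) ∈ opposing D ∧ r = viaDefeat ri rj := by
  have h := fun q' : Lit U => (pos_eq_map_old (p := .defeated ri) (f := PropSym.old (L := L)) q'
    (by simp)).symm
  rw [mem_R_iff, mem_rules]
  constructor
  · rintro ⟨((((⟨r, hr, rfl | rfl | rfl⟩ | ⟨r, hr, rfl | rfl | rfl | rfl⟩) |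
      ⟨r, hr, rfl | rfl | rfl⟩) | ⟨r, hr, rfl⟩) | ⟨q', hq, rfl⟩), e⟩ <;>
      simp [ns, s, strictHead, R1, R2, R3, viaDefeat, viaFail, NF, F, one, main, h] at e
    · subst e
      exact Or.inr ⟨r.2, hr, rfl⟩
    · subst e
      exact Or.inl ⟨hr, rfl⟩
  · rintro (⟨hr, rfl⟩ | ⟨rj, hr, rfl⟩)
    · exact ⟨Or.inl (Or.inl (Or.inr ⟨_, hr, Or.inl rfl⟩)), rfl⟩
    · exact ⟨Or.inl (Or.inl (Or.inl (Or.inr ⟨_, hr, Or.inr (Or.inr (Or.inr rfl))⟩))), rfl⟩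

theorem R_defeated_neg (ri : Rule U L) :
    (D.translate.addFacts A).R (.neg (.defeated ri)) = ∅ := by
  have h := fun q' : Lit U => (neg_eq_map_old (p := .defeated ri) (f := PropSym.old (L := L)) q'
    (by simp)).symm
  ext r
  rw [mem_R_iff, mem_rules]
  simp only [Set.mem_empty_iff_false, iff_false]
  rintro ⟨((((⟨r, hr, rfl | rfl | rfl⟩ | ⟨r, hr, rfl | rfl | rfl | rfl⟩) |
      ⟨r, hr, rfl | rfl | rfl⟩) | ⟨r, hr, rfl⟩) | ⟨q', hq, rfl⟩), e⟩ <;>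
    simp [ns, s, strictHead, R1, R2, R3, viaDefeat, viaFail, NF, F, one, main, h] at e

theorem mem_R_defeatedBy_pos (ri rj : Rule U L) (r : Rule (PropSym U L) (TLabel U L)) :
    r ∈ (D.translate.addFacts A).R (.pos (.defeatedBy ri rj)) ↔
      (ri, rj) ∈ opposing D ∧ (r = R2 ri rj ∨ r = R3 ri rj) := by
  have h := fun q' : Lit U => (pos_eq_map_old (p := .defeatedBy ri rj)
    (f := PropSym.old (L := L)) q' (by simp)).symm
  rw [mem_R_iff, mem_rules]
  constructor
  · rintro ⟨((((⟨r, hr, rfl | rfl | rfl⟩ | ⟨r, hr, rfl | rfl | rfl | rfl⟩) |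
      ⟨r, hr, rfl | rfl | rfl⟩) | ⟨r, hr, rfl⟩) | ⟨q', hq, rfl⟩), e⟩ <;>
      simp [ns, s, strictHead, R1, R2, R3, viaDefeat, viaFail, NF, F, one, main, h] at e
    · obtain ⟨rfl, rfl⟩ := e
      exact ⟨hr, Or.inl rfl⟩
    · obtain ⟨rfl, rfl⟩ := e
      exact ⟨hr, Or.inr rfl⟩
  · rintro ⟨hr, rfl | rfl⟩
    · exact ⟨Or.inl (Or.inl (Or.inl (Or.inr ⟨_, hr, Or.inr (Or.inl rfl)⟩))), rfl⟩
    · exact ⟨Or.inl (Or.inl (Or.inl (Or.inr ⟨_, hr, Or.inr (Or.inr (Or.inl rfl))⟩))), rfl⟩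

theorem mem_R_defeatedBy_neg (ri rj : Rule U L) (r : Rule (PropSym U L) (TLabel U L)) :
    r ∈ (D.translate.addFacts A).R (.neg (.defeatedBy ri rj)) ↔
      (ri, rj) ∈ opposing D ∧ r = R1 ri rj := by
  have h := fun q' : Lit U => (neg_eq_map_old (p := .defeatedBy ri rj)
    (f := PropSym.old (L := L)) q' (by simp)).symm
  rw [mem_R_iff, mem_rules]
  constructor
  · rintro ⟨((((⟨r, hr, rfl | rfl | rfl⟩ | ⟨r, hr, rfl | rfl | rfl | rfl⟩) |
      ⟨r, hr, rfl | rfl | rfl⟩) | ⟨r, hr, rfl⟩) | ⟨q', hq, rfl⟩), e⟩ <;>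
      simp [ns, s, strictHead, R1, R2, R3, viaDefeat, viaFail, NF, F, one, main, h] at e
    obtain ⟨rfl, rfl⟩ := e
    exact ⟨hr, rfl⟩
  · rintro ⟨hr, rfl⟩
    exact ⟨Or.inl (Or.inl (Or.inl (Or.inr ⟨_, hr, Or.inl rfl⟩))), rfl⟩

theorem mem_sup_iff (x : Rule (PropSym U L) (TLabel U L) × Rule (PropSym U L) (TLabel U L)) :
    x ∈ (D.translate.addFacts A).sup ↔
      (∃ r ∈ strictRules D, (ns r.head, s r) = x) ∨
      (∃ y ∈ opposing D, (y.2, y.1) ∈ D.sup ∧ (R2 y.1 y.2, R1 y.1 y.2) = x) ∨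
      (∃ y ∈ opposing D, (R3 y.1 y.2, R1 y.1 y.2) = x) ∨ ∃ r ∈ D.rules, (NF r, F r) = x := by
  simp only [addFacts, Theory.translate, Translation.sup, Finset.mem_union, Finset.mem_image,
    Finset.mem_filter, or_assoc, and_assoc]

theorem R2_R1_mem_sup (ri rj : Rule U L) (h : (ri, rj) ∈ opposing D) :
    (R2 ri rj, R1 ri rj) ∈ (D.translate.addFacts A).sup ↔ (rj, ri) ∈ D.sup := by
  simp only [mem_sup_iff]
  constructor
  · rintro (⟨r, -, e⟩ | ⟨⟨a, b⟩, -, hs, e⟩ | ⟨y, -, e⟩ | ⟨r, -, e⟩) <;>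
      simp [ns, s, R1, R2, R3, NF, F] at e
    rwa [← e.1.1.1, ← e.1.1.2]
  · exact fun hs => Or.inr (Or.inl ⟨_, h, hs, rfl⟩)

theorem R3_R1_mem_sup (ri rj : Rule U L) (h : (ri, rj) ∈ opposing D) :
    (R3 ri rj, R1 ri rj) ∈ (D.translate.addFacts A).sup :=
  (mem_sup_iff D A _).2 (Or.inr (Or.inr (Or.inl ⟨_, h, rfl⟩)))

/-- The rules for old literals are not superior to anything, so a conflict between `q` and `∼q` is
decided by the bodies of these rules alone. -/
theorem main_notMem_sup (q : Lit U) (r : Rule (PropSym U L) (TLabel U L)) :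
    (main D q, r) ∉ (D.translate.addFacts A).sup := by
  simp [mem_sup_iff, ns, s, R1, R2, R3, NF, F, main]

theorem strictHead_notMem_sup (q : Lit U) (r : Rule (PropSym U L) (TLabel U L)) :
    (strictHead q, r) ∉ (D.translate.addFacts A).sup := by
  simp [mem_sup_iff, ns, s, R1, R2, R3, NF, F, strictHead]

end Translate

end Translation

/-! ### The meaning of the new literals of `T(D)` -/

namespace Translation

open Theory Conclusion

variable {U L : Type*}

@[simp] theorem forall_mem_R1 (ri rj : Rule U L) (P : Lit (PropSym U L) → Prop) :
    (∀ a ∈ (R1 ri rj).body, P a) ↔ ∀ a ∈ ri.body, P (a.map .old) := forall_mem_oldBody _ _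

@[simp] theorem exists_mem_R1 (ri rj : Rule U L) (P : Lit (PropSym U L) → Prop) :
    (∃ a ∈ (R1 ri rj).body, P a) ↔ ∃ a ∈ ri.body, P (a.map .old) := exists_mem_oldBody _ _

@[simp] theorem forall_mem_R2 (ri rj : Rule U L) (P : Lit (PropSym U L) → Prop) :
    (∀ a ∈ (R2 ri rj).body, P a) ↔ ∀ a ∈ rj.body, P (a.map .old) := forall_mem_oldBody _ _

@[simp] theorem exists_mem_R2 (ri rj : Rule U L) (P : Lit (PropSym U L) → Prop) :
    (∃ a ∈ (R2 ri rj).body, P a) ↔ ∃ a ∈ rj.body, P (a.map .old) := exists_mem_oldBody _ _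

@[simp] theorem forall_mem_one (r : Rule U L) (P : Lit (PropSym U L) → Prop) :
    (∀ a ∈ (one r).body, P a) ↔ ∀ a ∈ r.body, P (a.map .old) := forall_mem_oldBody _ _

@[simp] theorem exists_mem_one (r : Rule U L) (P : Lit (PropSym U L) → Prop) :
    (∃ a ∈ (one r).body, P a) ↔ ∃ a ∈ r.body, P (a.map .old) := exists_mem_oldBody _ _

@[simp] theorem body_R3 (ri rj : Rule U L) : (R3 ri rj).body = {.pos (.strict rj.head)} := rfl

@[simp] theorem body_viaDefeat (ri rj : Rule U L) :
    (viaDefeat ri rj).body = {.pos (.defeatedBy ri rj)} := rfl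

@[simp] theorem body_viaFail (ri : Rule U L) : (viaFail ri).body = {.pos (.fail ri)} := rfl

/-- The new propositions that occur in the translation are not among the propositions of the
added facts. -/
def NewFor (Θ : Theory (PropSym U L) (TLabel U L)) (A : Set (Lit (PropSym U L))) : Prop :=
  ∀ l ∈ A, l.atom ∈ Θ.lang → ∃ p, l.atom = .old p

section

variable {D : Theory U L} {A : Set (Lit (PropSym U L))} (hA : NewFor D.translate A)
include hA

theorem notMem_facts_of_mem_lang {l : Lit (PropSym U L)} (hl : ∀ p, l.atom ≠ .old p)
    (h : l.atom ∈ D.translate.lang) : l ∉ (D.translate.addFacts A).facts := by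
  rintro (⟨q, -, rfl⟩ | h')
  · exact hl q.atom (by simp)
  · obtain ⟨p, hp⟩ := hA l h' h
    exact hl p hp

theorem notMem_facts_of_mem_R {l l' : Lit (PropSym U L)} {r : Rule (PropSym U L) (TLabel U L)}
    (hr : r ∈ (D.translate.addFacts A).R l') (hl : ∀ p, l.atom ≠ .old p)
    (h : l.atom = l'.atom) : l ∉ (D.translate.addFacts A).facts :=
  notMem_facts_of_mem_lang hA hl (Or.inr ⟨r, hr.1, Or.inl (by rw [hr.2, h])⟩)

/-- The added facts may use new propositions that do not occur in `T(D)`, hence the hypothesis on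
the language. It can hold without a strict rule for `q`, because `R3` mentions `strict(q)` too; then
the gadget has no rule for `strict(q)`. -/
theorem hasStrict_of_mem_lang (q : Lit U) (h : .strict q ∈ D.translate.lang) :
    HasStrict D (D.translate.addFacts A) q where
  pos_notMem := notMem_facts_of_mem_lang hA (by simp [Lit.atom]) h
  R_pos P := by
    simp only [mem_R_strict_pos]
    constructor
    · rintro ⟨_, ⟨r, hr, rfl⟩, hP⟩
      exact ⟨r, hr, hP⟩
    · rintro ⟨r, hr, hP⟩
      exact ⟨_, ⟨r, hr, rfl⟩, hP⟩
  R_neg r hr := mem_R_strict_neg D A q ⟨r, hr⟩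
  sup r := by simp [mem_sup_iff, ns, s, R1, R2, R3, NF, F]
  sup' r hr := (mem_sup_iff D A _).2
    (Or.inl ⟨r, by simpa [strictRules] using ⟨hr.1.1, hr.2⟩, by rw [hr.1.2]⟩)

theorem hasStrict_of_opposing {ri rj : Rule U L} (h : (ri, rj) ∈ opposing D) :
    HasStrict D (D.translate.addFacts A) rj.head :=
  hasStrict_of_mem_lang hA _ (Or.inr ⟨R3 ri rj,
    ((mem_R_defeatedBy_pos D A ri rj _).2 ⟨h, Or.inr rfl⟩).1,
    Or.inr ⟨.pos (.strict rj.head), by simp, rfl⟩⟩)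

theorem hasOld_translate :
    HasOld D (Lit.map .old ⁻¹' A) (D.translate.addFacts A) where
  facts q := by simp [addFacts, Theory.translate, map_old_inj]
  Rs q r := by
    change r ∈ (D.translate.addFacts A).R _ ∧ _ ↔ _
    rw [mem_R_old]
    constructor
    · rintro ⟨h | ⟨rfl, h⟩, h'⟩
      · exact h
      · simp [main] at h'
    · rintro ⟨rfl, h⟩
      exact ⟨Or.inl ⟨rfl, h⟩, rfl⟩
  hasStrict q h :=
    hasStrict_of_mem_lang hA q (Or.inr ⟨ns q, (mem_R_strict_neg D A q h).1, Or.inl rfl⟩)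

theorem hasFail_translate {r : Rule U L} (hr : r ∈ D.rules) :
    HasFail (D.translate.addFacts A) r where
  pos_notMem := notMem_facts_of_mem_R hA ((mem_R_fail_pos D A r _).2 ⟨hr, rfl⟩)
    (by simp [Lit.atom]) rfl
  neg_notMem := notMem_facts_of_mem_R hA ((mem_R_fail_pos D A r _).2 ⟨hr, rfl⟩)
    (by simp [Lit.atom]) rfl
  R_pos := by ext x; simp [mem_R_fail_pos, hr]
  R_neg := by ext x; simp [mem_R_fail_neg, hr]
  sup := by simp [mem_sup_iff, ns, s, R1, R2, R3, NF, F]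
  sup' := (mem_sup_iff D A _).2 (Or.inr (Or.inr (Or.inr ⟨r, hr, rfl⟩)))

variable {Y : Set (Conclusion (PropSym U L))} (hY : FixedAtNew (D.translate.addFacts A) Y)
include hY

omit hA in
theorem plus_strict {q : Lit U} (h : HasStrict D (D.translate.addFacts A) q) :
    plus .partialStar (.pos (.strict q)) ∈ Y ↔ plus .Delta (.pos (.strict q)) ∈ Y := by
  rw [(hY _ (by simp [Lit.atom]) .partialStar).1]
  exact h.plusSingle

omit hA in
theorem minus_strict {q : Lit U} (h : HasStrict D (D.translate.addFacts A) q) :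
    minus .partialStar (.pos (.strict q)) ∈ Y ↔ minus .Delta (.pos (.strict q)) ∈ Y := by
  rw [(hY _ (by simp [Lit.atom]) .partialStar).2]
  exact h.minusSingle

theorem plus_fail {r : Rule U L} (hr : r ∈ D.rules) :
    plus .partialStar (.pos (.fail r)) ∈ Y ↔
      ∃ a ∈ r.body, minus .partialStar (a.map .old) ∈ Y := by
  rw [(hY _ (by simp [Lit.atom]) .partialStar).1]
  exact (hasFail_translate hA hr).plusSingle hY

theorem minus_fail {r : Rule U L} (hr : r ∈ D.rules) :
    minus .partialStar (.pos (.fail r)) ∈ Y ↔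
      ∀ a ∈ r.body, plus .partialStar (a.map .old) ∈ Y := by
  rw [(hY _ (by simp [Lit.atom]) .partialStar).2]
  exact (hasFail_translate hA hr).minusSingle hY

/-- A new literal without strict rules for it or its complement and with no rule for its
complement is unopposed. -/
theorem unopposed {l : Lit (PropSym U L)} (hl : ∀ p, l.atom ≠ .old p)
    (hlang : l.atom ∈ D.translate.lang)
    (hR : (D.translate.addFacts A).R l.compl = ∅)
    (hRs : ∀ r ∈ (D.translate.addFacts A).R l, r.arrow = .defeasible) :
    (plus .partialStar l ∈ Y ↔ ∃ r ∈ (D.translate.addFacts A).R l,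
      ∀ a ∈ r.body, plus .partialStar a ∈ Y) ∧
    (minus .partialStar l ∈ Y ↔ ∀ r ∈ (D.translate.addFacts A).R l,
      ∃ a ∈ r.body, minus .partialStar a ∈ Y) := by
  have hl' : ∀ p, l.compl.atom ≠ .old p := by simpa using hl
  have hf := notMem_facts_of_mem_lang hA hl hlang
  have hf' := notMem_facts_of_mem_lang hA hl' (by simpa using hlang)
  have e1 : (D.translate.addFacts A).Rs l = ∅ := by
    ext r
    simp only [Rs, Set.mem_ofPred_eq, Set.mem_empty_iff_false, iff_false]
    rintro ⟨h, h'⟩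
    simp [hRs r h] at h'
  have e2 : (D.translate.addFacts A).Rs l.compl = ∅ := by
    ext r
    simp [Rs, hR]
  have e3 : (D.translate.addFacts A).Rsd l = (D.translate.addFacts A).R l := by
    ext r
    simp only [Rsd, Set.mem_ofPred_eq, and_iff_left_iff_imp]
    intro h
    simp [hRs r h]
  have d1 : plus .Delta l ∉ Y := by
    rw [(hY l hl _).1]
    simp [Infers, PlusDelta, e1, hf]
  have d2 : minus .Delta l ∈ Y := by
    rw [(hY l hl _).2]
    simp [Infers, MinusDelta, e1, hf]
  have d3 : plus .Delta l.compl ∉ Y := by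
    rw [(hY _ hl' _).1]
    simp [Infers, PlusDelta, e2, hf']
  have d4 : minus .Delta l.compl ∈ Y := by
    rw [(hY _ hl' _).2]
    simp [Infers, MinusDelta, e2, hf']
  constructor
  · rw [(hY l hl .partialStar).1]
    simp [Infers, PlusSingle, e3, d1, d4, hR]
  · rw [(hY l hl .partialStar).2]
    simp [Infers, MinusSingle, e3, d2, d3, hR]

theorem plus_one {q : Lit U} (hq : q ∈ ruleLits D) :
    plus .partialStar (.pos (.one q)) ∈ Y ↔
      ∃ r ∈ D.Rsd q, ∀ a ∈ r.body, plus .partialStar (a.map .old) ∈ Y := by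
  have hlang : .one q ∈ D.translate.lang := Or.inr ⟨main D q,
    ((mem_R_old D A q _).2 (Or.inr ⟨rfl, hq⟩)).1,
    Or.inr ⟨.pos (.one q), by simp [main], rfl⟩⟩
  rw [(unopposed hA hY (l := .pos (.one q)) (by simp [Lit.atom]) hlang (R_one_neg D A q) (by
    simp only [mem_R_one_pos]; rintro _ ⟨r, -, rfl⟩; rfl)).1]
  simp only [mem_R_one_pos]
  constructor
  · rintro ⟨_, ⟨r, hr, rfl⟩, hP⟩
    exact ⟨r, hr, by simpa using hP⟩
  · rintro ⟨r, hr, hP⟩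
    exact ⟨_, ⟨r, hr, rfl⟩, by simpa using hP⟩

theorem minus_one {q : Lit U} (hq : q ∈ ruleLits D) :
    minus .partialStar (.pos (.one q)) ∈ Y ↔
      ∀ r ∈ D.Rsd q, ∃ a ∈ r.body, minus .partialStar (a.map .old) ∈ Y := by
  have hlang : .one q ∈ D.translate.lang := Or.inr ⟨main D q,
    ((mem_R_old D A q _).2 (Or.inr ⟨rfl, hq⟩)).1,
    Or.inr ⟨.pos (.one q), by simp [main], rfl⟩⟩
  rw [(unopposed hA hY (l := .pos (.one q)) (by simp [Lit.atom]) hlang (R_one_neg D A q) (by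
    simp only [mem_R_one_pos]; rintro _ ⟨r, -, rfl⟩; rfl)).2]
  simp only [mem_R_one_pos]
  constructor
  · intro h r hr
    simpa using h _ ⟨r, hr, rfl⟩
  · rintro h _ ⟨r, hr, rfl⟩
    simpa using h r hr

theorem plus_defeated {ri : Rule U L} (hr : ri ∈ D.rules) :
    plus .partialStar (.pos (.defeated ri)) ∈ Y ↔
      plus .partialStar (.pos (.fail ri)) ∈ Y ∨
      ∃ rj, (ri, rj) ∈ opposing D ∧ plus .partialStar (.pos (.defeatedBy ri rj)) ∈ Y := by
  have hlang : .defeated ri ∈ D.translate.lang := Or.inr ⟨viaFail ri,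
    ((mem_R_defeated_pos D A ri _).2 (Or.inl ⟨hr, rfl⟩)).1, Or.inl rfl⟩
  rw [(unopposed hA hY (l := .pos (.defeated ri)) (by simp [Lit.atom]) hlang (R_defeated_neg D A ri) (by
    simp only [mem_R_defeated_pos]; rintro _ (⟨-, rfl⟩ | ⟨_, -, rfl⟩) <;> rfl)).1]
  simp only [mem_R_defeated_pos]
  constructor
  · rintro ⟨_, ⟨-, rfl⟩ | ⟨rj, h, rfl⟩, hP⟩
    · exact Or.inl (by simpa using hP)
    · exact Or.inr ⟨rj, h, by simpa using hP⟩
  · rintro (hP | ⟨rj, h, hP⟩)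
    · exact ⟨_, Or.inl ⟨hr, rfl⟩, by simpa using hP⟩
    · exact ⟨_, Or.inr ⟨rj, h, rfl⟩, by simpa using hP⟩

theorem minus_defeated {ri : Rule U L} (hr : ri ∈ D.rules) :
    minus .partialStar (.pos (.defeated ri)) ∈ Y ↔
      minus .partialStar (.pos (.fail ri)) ∈ Y ∧
      ∀ rj, (ri, rj) ∈ opposing D → minus .partialStar (.pos (.defeatedBy ri rj)) ∈ Y := by
  have hlang : .defeated ri ∈ D.translate.lang := Or.inr ⟨viaFail ri,
    ((mem_R_defeated_pos D A ri _).2 (Or.inl ⟨hr, rfl⟩)).1, Or.inl rfl⟩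
  rw [(unopposed hA hY (l := .pos (.defeated ri)) (by simp [Lit.atom]) hlang (R_defeated_neg D A ri) (by
    simp only [mem_R_defeated_pos]; rintro _ (⟨-, rfl⟩ | ⟨_, -, rfl⟩) <;> rfl)).2]
  simp only [mem_R_defeated_pos]
  constructor
  · intro h
    exact ⟨by simpa using h _ (Or.inl ⟨hr, rfl⟩),
      fun rj hj => by simpa using h _ (Or.inr ⟨rj, hj, rfl⟩)⟩
  · rintro ⟨h1, h2⟩ _ (⟨-, rfl⟩ | ⟨rj, h, rfl⟩)
    · simpa using h1
    · simpa using h2 rj h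

section DefeatedBy

variable {ri rj : Rule U L} (hij : (ri, rj) ∈ opposing D)
include hij

omit hY in
theorem Rsd_defeatedBy :
    (D.translate.addFacts A).Rsd (.pos (.defeatedBy ri rj)) = {R2 ri rj, R3 ri rj} ∧
    (D.translate.addFacts A).Rs (.pos (.defeatedBy ri rj)) = ∅ ∧
    (D.translate.addFacts A).R (.neg (.defeatedBy ri rj)) = {R1 ri rj} ∧
    .pos (.defeatedBy ri rj) ∉ (D.translate.addFacts A).facts ∧
    .neg (.defeatedBy ri rj) ∉ (D.translate.addFacts A).facts := by
  have hf := (mem_R_defeatedBy_pos D A ri rj _).2 ⟨hij, Or.inl rfl⟩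
  refine ⟨?_, ?_, ?_, notMem_facts_of_mem_R hA hf (by simp [Lit.atom]) rfl,
    notMem_facts_of_mem_R hA hf (by simp [Lit.atom]) rfl⟩
  · ext x
    simp only [Rsd, mem_R_defeatedBy_pos, hij, Set.mem_ofPred_eq, Set.mem_insert_iff,
      Set.mem_singleton_iff, true_and, and_iff_left_iff_imp]
    rintro (rfl | rfl) <;> simp [R2, R3]
  · ext x
    simp only [Rs, mem_R_defeatedBy_pos, hij, Set.mem_ofPred_eq, true_and,
      Set.mem_empty_iff_false, iff_false]
    rintro ⟨rfl | rfl, h⟩ <;> simp [R2, R3] at h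
  · ext x
    simp [mem_R_defeatedBy_neg, hij]

/-- The rule `R1 ri rj` inherits the arrow of `ri`, so a strict `ri` can make the negated literal a
strict conclusion. -/
theorem plus_Delta_not_defeatedBy :
    plus .Delta (.neg (.defeatedBy ri rj)) ∈ Y ↔
      ri.arrow = .strict ∧ ∀ a ∈ ri.body, plus .Delta (a.map .old) ∈ Y := by
  obtain ⟨-, -, h, -, hf⟩ := Rsd_defeatedBy hA hij
  rw [(hY _ (by simp [Lit.atom]) _).1]
  simp [Infers, PlusDelta, Rs, h, hf, and_assoc]
  simp [R1]

theorem minus_Delta_not_defeatedBy :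
    minus .Delta (.neg (.defeatedBy ri rj)) ∈ Y ↔
      (ri.arrow = .strict → ∃ a ∈ ri.body, minus .Delta (a.map .old) ∈ Y) := by
  obtain ⟨-, -, h, -, hf⟩ := Rsd_defeatedBy hA hij
  rw [(hY _ (by simp [Lit.atom]) _).2]
  simp [Infers, MinusDelta, Rs, h, hf]
  simp [R1]

/-- The only opponent is `R1 ri rj`. It never stops `R3 ri rj`, which is always superior, and it
stops an applicable `R2 ri rj` unless the body of `ri` is refuted or `rj > ri`. -/
theorem plus_defeatedBy :
    plus .partialStar (.pos (.defeatedBy ri rj)) ∈ Y ↔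
      minus .Delta (.neg (.defeatedBy ri rj)) ∈ Y ∧
      (((∀ a ∈ rj.body, plus .partialStar (a.map .old) ∈ Y) ∧
        ((∃ a ∈ ri.body, minus .partialStar (a.map .old) ∈ Y) ∨ (rj, ri) ∈ D.sup)) ∨
        plus .Delta (.pos (.strict rj.head)) ∈ Y) := by
  obtain ⟨h1, h2, h3, hf, -⟩ := Rsd_defeatedBy hA hij
  have d1 : plus .Delta (.pos (.defeatedBy ri rj)) ∉ Y := by
    rw [(hY _ (by simp [Lit.atom]) _).1]
    simp [Infers, PlusDelta, h2, hf]
  have hs := plus_strict hY (hasStrict_of_opposing hA hij)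
  rw [(hY _ (by simp [Lit.atom]) .partialStar).1]
  simp only [Infers, PlusSingle, d1, h1, h3, compl_pos, Set.mem_insert_iff,
    Set.mem_singleton_iff, forall_eq, exists_eq_or_imp, exists_eq_left, forall_mem_R2,
    exists_mem_R1, R2_R1_mem_sup D A ri rj hij, R3_R1_mem_sup D A ri rj hij, body_R3,
    Finset.mem_singleton, hs]
  grind

theorem minus_defeatedBy :
    minus .partialStar (.pos (.defeatedBy ri rj)) ∈ Y ↔
      plus .Delta (.neg (.defeatedBy ri rj)) ∈ Y ∨
      (((∃ a ∈ rj.body, minus .partialStar (a.map .old) ∈ Y) ∨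
        ((∀ a ∈ ri.body, plus .partialStar (a.map .old) ∈ Y) ∧ (rj, ri) ∉ D.sup)) ∧
        minus .Delta (.pos (.strict rj.head)) ∈ Y) := by
  obtain ⟨h1, h2, h3, hf, -⟩ := Rsd_defeatedBy hA hij
  have d1 : minus .Delta (.pos (.defeatedBy ri rj)) ∈ Y := by
    rw [(hY _ (by simp [Lit.atom]) _).2]
    simp [Infers, MinusDelta, h2, hf]
  have hs := minus_strict hY (hasStrict_of_opposing hA hij)
  rw [(hY _ (by simp [Lit.atom]) .partialStar).2]
  simp only [Infers, MinusSingle, d1, h1, h3, compl_pos, Set.mem_insert_iff,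
    Set.mem_singleton_iff, forall_eq, forall_eq_or_imp, exists_eq_left, exists_mem_R2,
    forall_mem_R1, R2_R1_mem_sup D A ri rj hij, R3_R1_mem_sup D A ri rj hij, body_R3,
    Finset.mem_singleton, hs]
  grind

end DefeatedBy

end

end Translation

/-! ### Team defeat in `D` against single defeat in `T(D)` -/

namespace Theory

/-- Take `r` maximal among the rules for `q` with `P`. If some `s > r` had `S`, then a rule `t > s`
with `P` would lie above `r`. The predicates are independent of each other because `Y` need be
neither consistent nor complete: "applicable" and "not refuted" may differ. -/
theorem IsDefeasible.exists_undefeated {U L : Type*} {D : Theory U L} (hD : D.IsDefeasible)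
    (q : Lit U) {P S : Rule U L → Prop} (hP : ∃ r ∈ D.Rsd q, P r)
    (hS : ∀ s ∈ D.R q.compl, S s → ∃ t ∈ D.Rsd q, P t ∧ (t, s) ∈ D.sup) :
    ∃ r ∈ D.Rsd q, P r ∧ ∀ s ∈ D.R q.compl, (s, r) ∈ D.sup → ¬ S s := by
  obtain ⟨r₀, hr₀, hPr₀⟩ := hP
  obtain ⟨r, -, ⟨hr, hPr⟩, hmax⟩ :=
    hD.exists_maximal (fun r => r ∈ D.Rsd q ∧ P r) ⟨r₀, hr₀.1.1, hr₀, hPr₀⟩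
  refine ⟨r, hr, hPr, fun s hs hsr hSs => ?_⟩
  obtain ⟨t, ht, hPt, hts⟩ := hS s hs hSs
  exact hmax t ht.1.1 ⟨ht, hPt⟩ (.tail (.single hts) hsr)

end Theory

namespace Translation

open Theory Conclusion

variable {U L : Type*}

theorem mem_opposing {D : Theory U L} {q : Lit U} {ri rj : Rule U L} (hi : ri ∈ D.R q.compl)
    (hj : rj ∈ D.Rsd q) : (ri, rj) ∈ opposing D := by
  obtain ⟨h, hq⟩ := hi
  obtain ⟨⟨h', rfl⟩, h3⟩ := hj
  simp only [opposing, Finset.mem_filter, Finset.mem_product]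
  exact ⟨⟨h, h'⟩, hq, h3⟩

theorem mem_Rsd_of_opposing {D : Theory U L} {q : Lit U} {ri rj : Rule U L}
    (hi : ri ∈ D.R q.compl) (h : (ri, rj) ∈ opposing D) : rj ∈ D.Rsd q := by
  simp only [opposing, Finset.mem_filter, Finset.mem_product] at h
  refine ⟨⟨h.1.2, ?_⟩, h.2.2⟩
  have := h.2.1
  rw [hi.2] at this
  rw [← Lit.compl_compl rj.head, ← this, Lit.compl_compl]

theorem mem_ruleLits_of_mem_R {D : Theory U L} {q : Lit U} {r : Rule U L} (h : r ∈ D.R q) :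
    q ∈ ruleLits D := by
  classical
  obtain ⟨h, rfl⟩ := h
  simp only [ruleLits, Finset.mem_union, Finset.mem_biUnion]
  exact Or.inl ⟨r, h, by simp⟩

section

variable {D : Theory U L} {A : Set (Lit (PropSym U L))} {q : Lit U}

theorem exists_Rsd_old (P : Rule (PropSym U L) (TLabel U L) → Prop) :
    (∃ r ∈ (D.translate.addFacts A).Rsd (q.map .old), P r) ↔
      ((D.Rs q).Nonempty ∧ P (strictHead q)) ∨ (q ∈ ruleLits D ∧ P (main D q)) := by
  constructor
  · rintro ⟨r, ⟨hr, -⟩, hP⟩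
    rcases (mem_R_old D A q r).1 hr with ⟨rfl, h⟩ | ⟨rfl, h⟩
    · exact Or.inl ⟨h, hP⟩
    · exact Or.inr ⟨h, hP⟩
  · rintro (⟨h, hP⟩ | ⟨h, hP⟩)
    · exact ⟨_, ⟨(mem_R_old D A q _).2 (Or.inl ⟨rfl, h⟩), by simp [strictHead]⟩, hP⟩
    · exact ⟨_, ⟨(mem_R_old D A q _).2 (Or.inr ⟨rfl, h⟩), by simp [main]⟩, hP⟩

theorem forall_Rsd_old (P : Rule (PropSym U L) (TLabel U L) → Prop) :
    (∀ r ∈ (D.translate.addFacts A).Rsd (q.map .old), P r) ↔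
      ((D.Rs q).Nonempty → P (strictHead q)) ∧ (q ∈ ruleLits D → P (main D q)) := by
  have := exists_Rsd_old (D := D) (A := A) (q := q) fun r => ¬ P r
  grind

theorem exists_R_old (P : Rule (PropSym U L) (TLabel U L) → Prop) :
    (∃ r ∈ (D.translate.addFacts A).R (q.map .old), P r) ↔
      ((D.Rs q).Nonempty ∧ P (strictHead q)) ∨ (q ∈ ruleLits D ∧ P (main D q)) := by
  simp only [mem_R_old]
  grind

theorem forall_R_old (P : Rule (PropSym U L) (TLabel U L) → Prop) :
    (∀ r ∈ (D.translate.addFacts A).R (q.map .old), P r) ↔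
      ((D.Rs q).Nonempty → P (strictHead q)) ∧ (q ∈ ruleLits D → P (main D q)) := by
  simp only [mem_R_old]
  grind

variable (hD : D.IsDefeasible) (hA : NewFor D.translate A)
  {Y : Set (Conclusion (PropSym U L))} (hY : FixedAtNew (D.translate.addFacts A) Y)
  (hp : ∀ q : Lit U, plus .Delta (q.map .old) ∈ Y ↔
    (D.addFacts (Lit.map .old ⁻¹' A)).PlusDelta (Conclusion.map Tag.star .old ⁻¹' Y) q)
  (hm : ∀ q : Lit U, minus .Delta (q.map .old) ∈ Y ↔
    (D.addFacts (Lit.map .old ⁻¹' A)).MinusDelta (Conclusion.map Tag.star .old ⁻¹' Y) q)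
include hD hA hY hp hm

/-- The body of `main D q` spells out the team defeat clause. What remains is the opponent `main D
q.compl`, which is refuted at `d(r)` for an undefeated applicable rule `r` for `q`. -/
theorem plusSingle_old_iff :
    (D.translate.addFacts A).PlusSingle Y .partialStar .partialStar (q.map .old) ↔
      (D.addFacts (Lit.map .old ⁻¹' A)).PlusTeam (Conclusion.map Tag.star .old ⁻¹' Y)
        .partial_ .partial_ q := by
  have hO := hasOld_translate hA
  have hps : ∀ q, HasStrict D (D.translate.addFacts A) q → plus .Delta (.pos (.strict q)) ∈ Y →
      plus .Delta (q.map .old) ∈ Y := fun q h h' => (hp q).2 (Or.inr ((h.plus_Delta hY).1 h'))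
  change _ ↔ plus .Delta (q.map .old) ∈ Y ∨
    ((∃ r ∈ D.Rsd q, ∀ a ∈ r.body, plus .partialStar (a.map .old) ∈ Y) ∧
      minus .Delta (q.compl.map .old) ∈ Y ∧
      ∀ s ∈ D.R q.compl, (∃ a ∈ s.body, minus .partialStar (a.map .old) ∈ Y) ∨
        ∃ t ∈ D.Rsd q, (∀ a ∈ t.body, plus .partialStar (a.map .old) ∈ Y) ∧ (t, s) ∈ D.sup)
  simp only [PlusSingle, exists_Rsd_old, Lit.map_compl, forall_R_old, main_notMem_sup,
    strictHead_notMem_sup, or_false, forall_mem_main, exists_mem_main, body_strictHead,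
    Finset.mem_singleton, forall_eq, exists_eq_left]
  constructor
  · rintro (h | ⟨hne, h, -⟩ | ⟨hq, ⟨h1, h2⟩, h3, -⟩)
    · exact Or.inl h
    · exact Or.inl (hps q (hO.hasStrict q hne) ((plus_strict hY (hO.hasStrict q hne)).1 h))
    -- If `d(s,t)` came from `R3`, then `strict(q)` holds and `q` is already a strict conclusion.
    -- Excluding this leaves only genuine defeat by `t`.
    · by_cases hΔ : plus .Delta (q.map .old) ∈ Y
      · exact Or.inl hΔ
      refine Or.inr ⟨(plus_one hA hY hq).1 h1, h3, fun s hs => ?_⟩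
      rcases (plus_defeated hA hY hs.1).1 (h2 s hs) with h | ⟨t, ht, h⟩
      · exact Or.inl ((plus_fail hA hY hs.1).1 h)
      · have ht' := mem_Rsd_of_opposing hs ht
        rcases ((plus_defeatedBy hA hY ht).1 h).2 with ⟨h, h'⟩ | h
        · exact h'.imp_right fun h' => ⟨t, ht', h, h'⟩
        · exact absurd (ht'.1.2 ▸ hps _ (hasStrict_of_opposing hA ht) h) hΔ
  · rintro (h | ⟨h1, h2, h3⟩)
    · exact Or.inl h
    have hq : q ∈ ruleLits D := let ⟨r, hr, _⟩ := h1; mem_ruleLits_of_mem_R hr.1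
    -- Strict refutation of `∼q` has three uses: strict rules for `∼q` do not establish `¬d(s,t)`,
    -- the rule `strictHead` for `∼q` is refuted, and so is the body of `R3` in the analysis of
    -- `d(r)`.
    have hms := ((hm q.compl).1 h2).2
    refine Or.inr (Or.inr ⟨hq, ⟨(plus_one hA hY hq).2 h1, fun s hs => ?_⟩, h2, fun hne => ?_,
      fun hq' => ?_⟩)
    · rw [plus_defeated hA hY hs.1, plus_fail hA hY hs.1]
      refine (h3 s hs).imp_right fun ⟨t, ht, h, h'⟩ => ?_
      have hop := mem_opposing hs ht
      refine ⟨t, hop, (plus_defeatedBy hA hY hop).2 ⟨?_, Or.inl ⟨h, Or.inr h'⟩⟩⟩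
      exact (minus_Delta_not_defeatedBy hA hY hop).2 fun hst => hms s ⟨hs, hst⟩
    · exact (minus_strict hY (hO.hasStrict _ hne)).2
        (((hO.hasStrict _ hne).minus_Delta hY).2 hms)
    -- The opponent `main D q.compl` is refuted at `d(r)`, for a maximal applicable rule `r` for
    -- `q`.
    · right
      obtain ⟨r, hr, hr1, hr2⟩ := hD.exists_undefeated q h1
        (S := fun s => ¬ ∃ a ∈ s.body, minus .partialStar (a.map .old) ∈ Y)
        fun s hs hSs => (h3 s hs).resolve_left hSs
      simp only [Lit.compl_compl]
      refine ⟨r, hr.1, ?_⟩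
      rw [minus_defeated hA hY hr.1.1, minus_fail hA hY hr.1.1]
      refine ⟨hr1, fun s hop => ?_⟩
      have hs := mem_Rsd_of_opposing (q := q.compl) (by simpa using hr.1) hop
      have hst := hasStrict_of_opposing hA hop
      rw [minus_defeatedBy hA hY hop]
      refine Or.inr ⟨?_, (hst.minus_Delta hY).2 (hs.1.2.symm ▸ hms)⟩
      -- If `s > r`, the choice of `r` makes the body of `s` refuted, so `R2` fails. Otherwise the
      -- applicable `R1` blocks `R2`, which is not superior to it.
      by_cases hsr : (s, r) ∈ D.sup
      · exact Or.inl (not_not.1 (hr2 s hs.1 hsr))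
      · exact Or.inr ⟨hr1, hsr⟩

theorem minusSingle_old_iff :
    (D.translate.addFacts A).MinusSingle Y .partialStar .partialStar (q.map .old) ↔
      (D.addFacts (Lit.map .old ⁻¹' A)).MinusTeam (Conclusion.map Tag.star .old ⁻¹' Y)
        .partial_ .partial_ q := by
  have hO := hasOld_translate hA
  have hps : ∀ q, HasStrict D (D.translate.addFacts A) q → plus .Delta (.pos (.strict q)) ∈ Y →
      plus .Delta (q.map .old) ∈ Y := fun q h h' => (hp q).2 (Or.inr ((h.plus_Delta hY).1 h'))
  change _ ↔ minus .Delta (q.map .old) ∈ Y ∧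
    ((∀ r ∈ D.Rsd q, ∃ a ∈ r.body, minus .partialStar (a.map .old) ∈ Y) ∨
      plus .Delta (q.compl.map .old) ∈ Y ∨
      ∃ s ∈ D.R q.compl, (∀ a ∈ s.body, plus .partialStar (a.map .old) ∈ Y) ∧
        ∀ t ∈ D.Rsd q, (∃ a ∈ t.body, minus .partialStar (a.map .old) ∈ Y) ∨ (t, s) ∉ D.sup)
  simp only [MinusSingle, forall_Rsd_old, Lit.map_compl, exists_R_old, main_notMem_sup,
    strictHead_notMem_sup, not_false_eq_true, and_true, forall_mem_main, exists_mem_main,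
    body_strictHead, Finset.mem_singleton, forall_eq, exists_eq_left]
  refine and_congr_right fun hΔ => ?_
  constructor
  · rintro ⟨-, h⟩
    by_cases hq : q ∈ ruleLits D
    swap
    · exact Or.inl fun r hr => absurd (mem_ruleLits_of_mem_R hr.1) hq
    rcases h hq with (h | ⟨s, hs, h⟩) | h | ⟨hne, h⟩ | ⟨hq', h1, h2⟩
    · exact Or.inl ((minus_one hA hY hq).1 h)
    · rw [minus_defeated hA hY hs.1, minus_fail hA hY hs.1] at h
      -- If `d(s,t)` is refuted because `¬d(s,t)` is strict, then `s` is strict with a strictly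
      -- proved body, and `∼q` is a strict conclusion.
      by_cases hc : plus .Delta (q.compl.map .old) ∈ Y
      · exact Or.inr (Or.inl hc)
      refine Or.inr (Or.inr ⟨s, hs, h.1, fun t ht => ?_⟩)
      have hop := mem_opposing hs ht
      rcases (minus_defeatedBy hA hY hop).1 (h.2 t hop) with h' | ⟨h', -⟩
      · have := (plus_Delta_not_defeatedBy hA hY hop).1 h'
        exact absurd ((hp q.compl).2 (Or.inr ⟨s, ⟨hs, this.1⟩, this.2⟩)) hc
      · exact h'.imp_right And.right
    · exact Or.inr (Or.inl h)
    · exact Or.inr (Or.inl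
        (hps _ (hO.hasStrict _ hne) ((plus_strict hY (hO.hasStrict _ hne)).1 h)))
    · by_cases hc : plus .Delta (q.compl.map .old) ∈ Y
      · exact Or.inr (Or.inl hc)
      -- Here `main D q.compl` applies: every unrefuted rule for `q` is beaten by an applicable rule
      -- for `∼q`. A maximal applicable rule for `∼q` is then the single attacker that the clause
      -- `-∂` asks for.
      obtain ⟨s, hs, hs1, hs2⟩ := hD.exists_undefeated q.compl ((plus_one hA hY hq').1 h1)
        (S := fun t => ¬ ∃ a ∈ t.body, minus .partialStar (a.map .old) ∈ Y) (by
          intro t ht hSt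
          rcases (plus_defeated hA hY ht.1).1 (h2 t ht) with h | ⟨s, hop, h⟩
          · exact absurd ((plus_fail hA hY ht.1).1 h) hSt
          · have hs := mem_Rsd_of_opposing ht hop
            rcases ((plus_defeatedBy hA hY hop).1 h).2 with ⟨h, h'⟩ | h
            · exact ⟨s, hs, h, h'.resolve_left hSt⟩
            · exact absurd (hs.1.2 ▸ hps _ (hasStrict_of_opposing hA hop) h) hc)
      refine Or.inr (Or.inr ⟨s, hs.1, hs1, fun t ht => ?_⟩)
      by_cases hts : (t, s) ∈ D.sup
      · exact Or.inl (not_not.1 (hs2 t (by simpa using ht.1) hts))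
      · exact Or.inr hts
  · intro h
    refine ⟨fun hne => Or.inl ?_, fun hq => ?_⟩
    · exact (minus_strict hY (hO.hasStrict _ hne)).2
        (((hO.hasStrict _ hne).minus_Delta hY).2 ((hm q).1 hΔ).2)
    rcases h with h | h | ⟨s, hs, h1, h2⟩
    · exact Or.inl (Or.inl ((minus_one hA hY hq).2 h))
    · exact Or.inr (Or.inl h)
    · refine Or.inl (Or.inr ⟨s, hs, ?_⟩)
      rw [minus_defeated hA hY hs.1, minus_fail hA hY hs.1]
      refine ⟨h1, fun t hop => ?_⟩
      have ht := mem_Rsd_of_opposing hs hop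
      refine (minus_defeatedBy hA hY hop).2 (Or.inr ⟨(h2 t ht).imp_right fun h => ⟨h1, h⟩, ?_⟩)
      exact ((hasStrict_of_opposing hA hop).minus_Delta hY).2 (ht.1.2.symm ▸ ((hm q).1 hΔ).2)

end

/-! ### From agreement of inference steps to simulation -/

/-- Fixed points at the conclusions about new propositions. -/
theorem fixedAtNew_of {Θ : Theory (PropSym U L) (TLabel U L)} {S : Set Tag}
    {Y : Set (Conclusion (PropSym U L))}
    (h : ∀ b, b ∉ Conclusion.map Tag.star .old '' {c : Conclusion U | c.tag ∈ S} →
      (b ∈ Y ↔ b ∈ Θ.step Y)) : FixedAtNew Θ Y := by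
  intro l hl d
  constructor <;> refine h _ ?_ <;> rintro ⟨⟨d, q⟩ | ⟨d, q⟩, -, e⟩ <;>
    simp only [Conclusion.map, plus.injEq, minus.injEq, reduceCtorEq] at e <;>
    exact hl q.atom (by rw [← e.2, Lit.atom_map])

/-- Simulation follows if all sets of conclusions that are closed at the new propositions
satisfy the inference rules of both theories alike. -/
theorem simulatedBy_of_key (D : Theory U L) (T : Theory (PropSym U L) (TLabel U L)) (S : Set Tag)
    (d : Tag) (hS : Set.InjOn Tag.star S) (hΔ : .Delta ∈ S) (hd : d ∈ S)
    (hloc : ∀ (A : Set (Lit U)) X, ∀ c : Conclusion U, c.tag ∈ S → (D.addFacts A).Infers X c →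
      (D.addFacts A).Infers (X ∩ {c | c.tag ∈ S}) c)
    (hO : ∀ A, NewFor T A → HasOld D (Lit.map .old ⁻¹' A) (T.addFacts A))
    (key : ∀ A, NewFor T A → ∀ Y, FixedAtNew (T.addFacts A) Y →
      (∀ q : Lit U, plus .Delta (q.map .old) ∈ Y ↔
        (D.addFacts (Lit.map .old ⁻¹' A)).PlusDelta (Conclusion.map Tag.star .old ⁻¹' Y) q) →
      (∀ q : Lit U, minus .Delta (q.map .old) ∈ Y ↔
        (D.addFacts (Lit.map .old ⁻¹' A)).MinusDelta (Conclusion.map Tag.star .old ⁻¹' Y) q) →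
      ∀ c : Conclusion U, c.tag ∈ S → c.tag ≠ .Delta →
        ((T.addFacts A).Infers Y (c.map Tag.star .old) ↔
        (D.addFacts (Lit.map .old ⁻¹' A)).Infers (Conclusion.map Tag.star .old ⁻¹' Y) c)) :
    (D.map (PropSym.oldEmb U L)).SimulatedBy d d.star T := by
  intro A hA q hq
  have hnew : NewFor T A := by
    intro l hl hl'
    obtain ⟨p, -, hp⟩ := hA ⟨⟨l, hl, rfl⟩, hl'⟩
    exact ⟨p, hp.symm⟩
  obtain ⟨q, rfl⟩ : ∃ q' : Lit U, q = q'.map .old := by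
    obtain ⟨p, -, hp⟩ := hq
    cases q with
    | pos x => exact ⟨.pos p, congrArg Lit.pos hp.symm⟩
    | neg x => exact ⟨.neg p, congrArg Lit.neg hp.symm⟩
  have main : ∀ c : Conclusion U, c.tag ∈ S →
      (((D.map (PropSym.oldEmb U L)).addFacts A).Proves (c.map id .old) ↔
        (T.addFacts A).Proves (c.map Tag.star .old)) := by
    intro c hc
    have hmap : ((D.map (PropSym.oldEmb U L)).addFacts A).Proves (c.map id .old) ↔
        (D.addFacts (Lit.map .old ⁻¹' A)).Proves c := proves_map D (PropSym.oldEmb U L) A c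
    rw [hmap]
    have hinj : Set.InjOn (Conclusion.map Tag.star (PropSym.old (U := U) (L := L)))
        {c | c.tag ∈ S} := map_injOn hS (PropSym.oldEmb U L).injective
    have hloc' : ∀ X, ∀ c ∈ {c : Conclusion U | c.tag ∈ S},
        c ∈ (D.addFacts (Lit.map .old ⁻¹' A)).step X →
        c ∈ (D.addFacts (Lit.map .old ⁻¹' A)).step (X ∩ {c | c.tag ∈ S}) :=
      fun X c hc h => hloc _ X c hc h
    refine OrderHom.mem_lfp_iff_of_key _ (T.addFacts A).step _ _ hinj hloc' ?_ c hc
    intro Y hY hY' c hc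
    have hYn := fixedAtNew_of hY
    have hp := (hO A hnew).plusDelta hYn
    have hm := (hO A hnew).minusDelta hYn
    by_cases hcΔ : c.tag = .Delta
    · rcases c with ⟨d, q⟩ | ⟨d, q⟩ <;> obtain rfl : d = .Delta := hcΔ
      · exact hp q
      · exact hm q
    refine key A hnew Y hYn (fun q => ?_) (fun q => ?_) c hc hcΔ
    -- Whichever operator `Y` is fixed for, the strict conclusions in `Y` obey the strict clauses of
    -- `D`, since those of the two theories agree.
    · rcases hY' with h | h
      · exact (h (plus .Delta q) hΔ).trans (hp q)
      · exact h (plus .Delta q) hΔ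
    · rcases hY' with h | h
      · exact (h (minus .Delta q) hΔ).trans (hm q)
      · exact h (minus .Delta q) hΔ
  exact ⟨main (plus .Delta q) hΔ, main (minus .Delta q) hΔ, main (plus d q) hd,
    main (minus d q) hd⟩

theorem simulatedBy_translate (D : Theory U L) (hD : D.IsDefeasible) :
    (D.map (PropSym.oldEmb U L)).SimulatedBy .partial_ .partialStar D.translate := by
  refine simulatedBy_of_key D D.translate {.Delta, .partial_} .partial_ ?_ (by simp) (by simp)
    (fun A X c hc h => infers_inter_partial _ X c hc h) (fun A h => hasOld_translate h) ?_
  · rintro d (rfl | rfl) d' (rfl | rfl) e <;> simp_all [Tag.star]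
  · rintro A hA Y hY hp hm (⟨d, q⟩ | ⟨d, q⟩) (rfl | rfl) hd
    · exact absurd rfl hd
    · exact plusSingle_old_iff hD hA hY hp hm
    · exact absurd rfl hd
    · exact minusSingle_old_iff hD hA hY hp hm

end Translation

/-! ### The translation for ambiguity propagation -/

namespace Translation

open Theory Conclusion

section Definitions

open Classical

variable {U L : Type*}

/-- `B, fail(r₁), …, fail(rₖ) ⇝ q`, for `r = (B ↪ q)`, where `r₁, …, rₖ` are the strict or defeasible
rules for `∼q` that are superior to `r` -/
noncomputable def attack (D : Theory U L) (r : Rule U L) : Rule (PropSym U L) (TLabel U L) :=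
  -- The label is borrowed from the first translation, as is `one` for `support`. It matters only
  -- that these labels differ from those of the rules in the superiority relation.
  ⟨.viaFail r,
    oldBody r.body ∪ ((D.rules.filter fun t =>
      t.head = r.head.compl ∧ t.arrow ≠ .defeater ∧ (t, r) ∈ D.sup).image
        fun t => .pos (.fail t)),
    .defeater, r.head.map .old⟩

/-- `B, fail(r₁), …, fail(rₖ) ⇒ q`, for `r = (B ↪ q)`, where `r₁, …, rₖ` are the rules for `∼q` that
are superior to `r` -/
noncomputable def support (D : Theory U L) (r : Rule U L) : Rule (PropSym U L) (TLabel U L) :=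
  ⟨.one r,
    oldBody r.body ∪ ((D.rules.filter fun t =>
      t.head = r.head.compl ∧ (t, r) ∈ D.sup).image fun t => .pos (.fail t)),
    .defeasible, r.head.map .old⟩

/-- The rules of the translation for ambiguity propagating logics. -/
noncomputable def propagatingRules (D : Theory U L) :
    Finset (Rule (PropSym U L) (TLabel U L)) :=
  ((strictRules D).biUnion fun r => {ns r.head, s r, strictHead r.head}) ∪
  (D.rules.biUnion fun r => {NF r, F r, attack D r}) ∪
  ((D.rules.filter fun r => r.arrow ≠ .defeater).image (support D))

/-- The superiority relation of the translation for ambiguity propagating logics. -/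
noncomputable def propagatingSup (D : Theory U L) :
    Finset (Rule (PropSym U L) (TLabel U L) × Rule (PropSym U L) (TLabel U L)) :=
  ((strictRules D).image fun r => (ns r.head, s r)) ∪ (D.rules.image fun r => (NF r, F r))

end Definitions

end Translation

/-- The translation for ambiguity propagating logics. -/
noncomputable def Theory.translatePropagating {U L : Type*} (D : Theory U L) :
    Theory (PropSym U L) (TLabel U L) where
  lang := PropSym.old '' D.lang ∪
    {p | ∃ r ∈ Translation.propagatingRules D, p = r.head.atom ∨ ∃ a ∈ r.body, p = a.atom}
  facts := Lit.map PropSym.old '' D.facts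
  rules := Translation.propagatingRules D
  sup := Translation.propagatingSup D

namespace Translation

open Theory Conclusion

variable {U L : Type*}

section Rules

variable (D : Theory U L) (A : Set (Lit (PropSym U L)))

theorem forall_mem_attack {q : Lit U} {r : Rule U L} (h : r ∈ D.R q)
    (P : Lit (PropSym U L) → Prop) : (∀ a ∈ (attack D r).body, P a) ↔
      (∀ a ∈ r.body, P (a.map .old)) ∧
        ∀ t ∈ D.Rsd q.compl, (t, r) ∈ D.sup → P (.pos (.fail t)) := by
  obtain ⟨-, rfl⟩ := h
  simp only [attack, Finset.forall_mem_union, forall_mem_oldBody, Finset.forall_mem_image,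
    Finset.mem_filter, Rsd, R, Set.mem_ofPred_eq]
  grind

theorem exists_mem_attack {q : Lit U} {r : Rule U L} (h : r ∈ D.R q)
    (P : Lit (PropSym U L) → Prop) : (∃ a ∈ (attack D r).body, P a) ↔
      (∃ a ∈ r.body, P (a.map .old)) ∨
        ∃ t ∈ D.Rsd q.compl, (t, r) ∈ D.sup ∧ P (.pos (.fail t)) := by
  have := forall_mem_attack D h fun a => ¬ P a
  grind

theorem forall_mem_support {q : Lit U} {r : Rule U L} (h : r ∈ D.R q)
    (P : Lit (PropSym U L) → Prop) : (∀ a ∈ (support D r).body, P a) ↔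
      (∀ a ∈ r.body, P (a.map .old)) ∧
        ∀ t ∈ D.R q.compl, (t, r) ∈ D.sup → P (.pos (.fail t)) := by
  obtain ⟨-, rfl⟩ := h
  simp only [support, Finset.forall_mem_union, forall_mem_oldBody, Finset.forall_mem_image,
    Finset.mem_filter, R, Set.mem_ofPred_eq]
  grind

theorem exists_mem_support {q : Lit U} {r : Rule U L} (h : r ∈ D.R q)
    (P : Lit (PropSym U L) → Prop) : (∃ a ∈ (support D r).body, P a) ↔
      (∃ a ∈ r.body, P (a.map .old)) ∨
        ∃ t ∈ D.R q.compl, (t, r) ∈ D.sup ∧ P (.pos (.fail t)) := by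
  have := forall_mem_support D h fun a => ¬ P a
  grind

theorem mem_propagatingRules (r : Rule (PropSym U L) (TLabel U L)) :
    r ∈ propagatingRules D ↔
      ((∃ x, (x ∈ D.rules ∧ x.arrow = .strict) ∧
        (r = ns x.head ∨ r = s x ∨ r = strictHead x.head)) ∨
        (∃ x ∈ D.rules, r = NF x ∨ r = F x ∨ r = attack D x)) ∨
        (∃ x, (x ∈ D.rules ∧ x.arrow ≠ .defeater) ∧ support D x = r) := by
  simp only [propagatingRules, strictRules, Finset.mem_union, Finset.mem_biUnion,
    Finset.mem_insert, Finset.mem_singleton, Finset.mem_image, Finset.mem_filter]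

theorem mem_R_propagating_iff (l : Lit (PropSym U L)) (r : Rule (PropSym U L) (TLabel U L)) :
    r ∈ (D.translatePropagating.addFacts A).R l ↔ r ∈ propagatingRules D ∧ r.head = l := Iff.rfl

theorem mem_R_propagating_old (q : Lit U) (r : Rule (PropSym U L) (TLabel U L)) :
    r ∈ (D.translatePropagating.addFacts A).R (q.map .old) ↔
      (r = strictHead q ∧ (D.Rs q).Nonempty) ∨ (∃ r' ∈ D.R q, r = attack D r') ∨
        ∃ r' ∈ D.Rsd q, r = support D r' := by
  rw [mem_R_propagating_iff, mem_propagatingRules]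
  simp only [Set.Nonempty, Rs, Rsd, R, Set.mem_ofPred_eq]
  constructor
  · rintro ⟨((⟨r, hr, rfl | rfl | rfl⟩ | ⟨r, hr, rfl | rfl | rfl⟩) | ⟨r, hr, rfl⟩), h⟩ <;>
      simp only [ns, s, strictHead, NF, F, attack, support, map_old_inj] at h <;> first
      | exact absurd h (pos_eq_map_old q (by simp))
      | exact absurd h (neg_eq_map_old q (by simp))
      | skip
    · subst h
      exact Or.inl ⟨rfl, r, ⟨hr.1, rfl⟩, hr.2⟩
    · exact Or.inr (Or.inl ⟨r, ⟨hr, h⟩, rfl⟩)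
    · exact Or.inr (Or.inr ⟨r, ⟨⟨hr.1, h⟩, hr.2⟩, rfl⟩)
  · rintro (⟨rfl, r, ⟨hr, rfl⟩, hr'⟩ | ⟨r, ⟨hr, rfl⟩, rfl⟩ | ⟨r, ⟨⟨hr, rfl⟩, hr'⟩, rfl⟩)
    · exact ⟨Or.inl (Or.inl ⟨r, ⟨hr, hr'⟩, Or.inr (Or.inr rfl)⟩), rfl⟩
    · exact ⟨Or.inl (Or.inr ⟨r, hr, Or.inr (Or.inr rfl)⟩), rfl⟩
    · exact ⟨Or.inr ⟨r, ⟨hr, hr'⟩, rfl⟩, rfl⟩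

theorem mem_R_propagating_strict_pos (q : Lit U) (r : Rule (PropSym U L) (TLabel U L)) :
    r ∈ (D.translatePropagating.addFacts A).R (.pos (.strict q)) ↔ ∃ r' ∈ D.Rs q, r = s r' := by
  have h := fun q' : Lit U => (pos_eq_map_old (p := .strict q) (f := PropSym.old (L := L)) q'
    (by simp)).symm
  rw [mem_R_propagating_iff, mem_propagatingRules]
  simp only [Set.mem_ofPred_eq, Rs, R]
  constructor
  · rintro ⟨((⟨r, hr, rfl | rfl | rfl⟩ | ⟨r, hr, rfl | rfl | rfl⟩) | ⟨r, hr, rfl⟩), e⟩ <;>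
      simp [ns, s, strictHead, NF, F, attack, support, h] at e
    exact ⟨r, ⟨⟨hr.1, e⟩, hr.2⟩, rfl⟩
  · rintro ⟨r, ⟨⟨hr, rfl⟩, hr'⟩, rfl⟩
    exact ⟨Or.inl (Or.inl ⟨r, ⟨hr, hr'⟩, Or.inr (Or.inl rfl)⟩), rfl⟩

theorem mem_R_propagating_strict_neg (q : Lit U) (h : (D.Rs q).Nonempty) :
    ns q ∈ (D.translatePropagating.addFacts A).R (.neg (.strict q)) := by
  obtain ⟨r, ⟨hr, rfl⟩, hr'⟩ := h
  rw [mem_R_propagating_iff, mem_propagatingRules]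
  exact ⟨Or.inl (Or.inl ⟨r, ⟨hr, hr'⟩, Or.inl rfl⟩), rfl⟩

theorem mem_R_propagating_fail_pos (r₀ : Rule U L) (r : Rule (PropSym U L) (TLabel U L)) :
    r ∈ (D.translatePropagating.addFacts A).R (.pos (.fail r₀)) ↔ r₀ ∈ D.rules ∧ r = F r₀ := by
  have h := fun q' : Lit U => (pos_eq_map_old (p := .fail r₀) (f := PropSym.old (L := L)) q'
    (by simp)).symm
  rw [mem_R_propagating_iff, mem_propagatingRules]
  constructor
  · rintro ⟨((⟨r, hr, rfl | rfl | rfl⟩ | ⟨r, hr, rfl | rfl | rfl⟩) | ⟨r, hr, rfl⟩), e⟩ <;>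
      simp [ns, s, strictHead, NF, F, attack, support, h] at e
    subst e
    exact ⟨hr, rfl⟩
  · rintro ⟨hr, rfl⟩
    exact ⟨Or.inl (Or.inr ⟨_, hr, Or.inr (Or.inl rfl)⟩), rfl⟩

theorem mem_R_propagating_fail_neg (r₀ : Rule U L) (r : Rule (PropSym U L) (TLabel U L)) :
    r ∈ (D.translatePropagating.addFacts A).R (.neg (.fail r₀)) ↔ r₀ ∈ D.rules ∧ r = NF r₀ := by
  have h := fun q' : Lit U => (neg_eq_map_old (p := .fail r₀) (f := PropSym.old (L := L)) q'
    (by simp)).symm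
  rw [mem_R_propagating_iff, mem_propagatingRules]
  constructor
  · rintro ⟨((⟨r, hr, rfl | rfl | rfl⟩ | ⟨r, hr, rfl | rfl | rfl⟩) | ⟨r, hr, rfl⟩), e⟩ <;>
      simp [ns, s, strictHead, NF, F, attack, support, h] at e
    subst e
    exact ⟨hr, rfl⟩
  · rintro ⟨hr, rfl⟩
    exact ⟨Or.inl (Or.inr ⟨_, hr, Or.inl rfl⟩), rfl⟩

theorem mem_propagatingSup_iff
    (x : Rule (PropSym U L) (TLabel U L) × Rule (PropSym U L) (TLabel U L)) :
    x ∈ (D.translatePropagating.addFacts A).sup ↔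
      (∃ r, (r ∈ D.rules ∧ r.arrow = .strict) ∧ (ns r.head, s r) = x) ∨
        ∃ r ∈ D.rules, (NF r, F r) = x := by
  simp only [addFacts, translatePropagating, propagatingSup, strictRules, Finset.mem_union,
    Finset.mem_image, Finset.mem_filter]

/-- The rules for old literals are not in the superiority relation. -/
theorem notMem_propagatingSup {q : Lit U} {r r' : Rule (PropSym U L) (TLabel U L)}
    (h : r ∈ (D.translatePropagating.addFacts A).R (q.map .old)) :
    (r, r') ∉ (D.translatePropagating.addFacts A).sup ∧
      (r', r) ∉ (D.translatePropagating.addFacts A).sup := by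
  rcases (mem_R_propagating_old D A q r).1 h with ⟨rfl, -⟩ | ⟨r, -, rfl⟩ | ⟨r, -, rfl⟩ <;>
    simp [mem_propagatingSup_iff, ns, s, NF, F, strictHead, attack, support]

end Rules

section

variable {D : Theory U L} {A : Set (Lit (PropSym U L))} {q : Lit U}

theorem exists_Rsd_propagating (P : Rule (PropSym U L) (TLabel U L) → Prop) :
    (∃ r ∈ (D.translatePropagating.addFacts A).Rsd (q.map .old), P r) ↔
      ((D.Rs q).Nonempty ∧ P (strictHead q)) ∨ ∃ r ∈ D.Rsd q, P (support D r) := by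
  constructor
  · rintro ⟨r, ⟨hr, hr'⟩, hP⟩
    rcases (mem_R_propagating_old D A q r).1 hr with ⟨rfl, h⟩ | ⟨r, h, rfl⟩ | ⟨r, h, rfl⟩
    · exact Or.inl ⟨h, hP⟩
    · exact absurd rfl hr'
    · exact Or.inr ⟨r, h, hP⟩
  · rintro (⟨h, hP⟩ | ⟨r, h, hP⟩)
    · exact ⟨_, ⟨(mem_R_propagating_old D A q _).2 (Or.inl ⟨rfl, h⟩), by simp [strictHead]⟩, hP⟩
    · exact ⟨_, ⟨(mem_R_propagating_old D A q _).2 (Or.inr (Or.inr ⟨r, h, rfl⟩)),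
        by simp [support]⟩, hP⟩

theorem forall_Rsd_propagating (P : Rule (PropSym U L) (TLabel U L) → Prop) :
    (∀ r ∈ (D.translatePropagating.addFacts A).Rsd (q.map .old), P r) ↔
      ((D.Rs q).Nonempty → P (strictHead q)) ∧ ∀ r ∈ D.Rsd q, P (support D r) := by
  have := exists_Rsd_propagating (D := D) (A := A) (q := q) fun r => ¬ P r
  grind

theorem exists_R_propagating (P : Rule (PropSym U L) (TLabel U L) → Prop) :
    (∃ r ∈ (D.translatePropagating.addFacts A).R (q.map .old), P r) ↔
      ((D.Rs q).Nonempty ∧ P (strictHead q)) ∨ (∃ r ∈ D.R q, P (attack D r)) ∨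
        ∃ r ∈ D.Rsd q, P (support D r) := by
  simp only [mem_R_propagating_old]
  grind

theorem forall_R_propagating (P : Rule (PropSym U L) (TLabel U L) → Prop) :
    (∀ r ∈ (D.translatePropagating.addFacts A).R (q.map .old), P r) ↔
      ((D.Rs q).Nonempty → P (strictHead q)) ∧ (∀ r ∈ D.R q, P (attack D r)) ∧
        ∀ r ∈ D.Rsd q, P (support D r) := by
  simp only [mem_R_propagating_old]
  grind

variable (hA : NewFor D.translatePropagating A)
include hA

theorem notMem_facts_propagating {l l' : Lit (PropSym U L)}
    {r : Rule (PropSym U L) (TLabel U L)}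
    (hr : r ∈ (D.translatePropagating.addFacts A).R l') (hl : ∀ p, l.atom ≠ .old p)
    (h : l.atom = l'.atom) : l ∉ (D.translatePropagating.addFacts A).facts := by
  rintro (⟨q, -, rfl⟩ | h')
  · exact hl q.atom (by simp)
  · obtain ⟨p, hp⟩ := hA l h' (Or.inr ⟨r, hr.1, Or.inl (by rw [hr.2, h])⟩)
    exact hl p hp

theorem hasOld_propagating :
    HasOld D (Lit.map .old ⁻¹' A) (D.translatePropagating.addFacts A) where
  facts q := by simp [addFacts, Theory.translatePropagating, map_old_inj]
  Rs q r := by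
    change r ∈ (D.translatePropagating.addFacts A).R _ ∧ _ ↔ _
    rw [mem_R_propagating_old]
    constructor
    · rintro ⟨h | ⟨r, h, rfl⟩ | ⟨r, h, rfl⟩, h'⟩
      · exact h
      · simp [attack] at h'
      · simp [support] at h'
    · rintro ⟨rfl, h⟩
      exact ⟨Or.inl ⟨rfl, h⟩, rfl⟩
  hasStrict q h :=
    { pos_notMem := notMem_facts_propagating hA (mem_R_propagating_strict_neg D A q h)
        (by simp [Lit.atom]) rfl
      R_pos := fun P => by
        simp only [mem_R_propagating_strict_pos]
        constructor
        · rintro ⟨_, ⟨r, hr, rfl⟩, hP⟩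
          exact ⟨r, hr, hP⟩
        · rintro ⟨r, hr, hP⟩
          exact ⟨_, ⟨r, hr, rfl⟩, hP⟩
      R_neg := fun r hr => mem_R_propagating_strict_neg D A q ⟨r, hr⟩
      sup := fun r => by simp [mem_propagatingSup_iff, ns, s, NF, F]
      sup' := fun r hr => (mem_propagatingSup_iff D A _).2
        (Or.inl ⟨r, ⟨hr.1.1, hr.2⟩, by rw [hr.1.2]⟩) }

theorem hasFail_propagating {r : Rule U L} (hr : r ∈ D.rules) :
    HasFail (D.translatePropagating.addFacts A) r where
  pos_notMem := notMem_facts_propagating hA ((mem_R_propagating_fail_pos D A r _).2 ⟨hr, rfl⟩)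
    (by simp [Lit.atom]) rfl
  neg_notMem := notMem_facts_propagating hA ((mem_R_propagating_fail_pos D A r _).2 ⟨hr, rfl⟩)
    (by simp [Lit.atom]) rfl
  R_pos := by ext x; simp [mem_R_propagating_fail_pos, hr]
  R_neg := by ext x; simp [mem_R_propagating_fail_neg, hr]
  sup := by simp [mem_propagatingSup_iff, ns, s, NF, F]
  sup' := (mem_propagatingSup_iff D A _).2 (Or.inr ⟨r, hr, rfl⟩)

variable {Y : Set (Conclusion (PropSym U L))}
  (hY : FixedAtNew (D.translatePropagating.addFacts A) Y)
  (hp : ∀ q : Lit U, plus .Delta (q.map .old) ∈ Y ↔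
    (D.addFacts (Lit.map .old ⁻¹' A)).PlusDelta (Conclusion.map Tag.star .old ⁻¹' Y) q)
  (hm : ∀ q : Lit U, minus .Delta (q.map .old) ∈ Y ↔
    (D.addFacts (Lit.map .old ⁻¹' A)).MinusDelta (Conclusion.map Tag.star .old ⁻¹' Y) q)
include hY

theorem plus_deltaStar_fail {r : Rule U L} (hr : r ∈ D.rules) :
    plus .deltaStar (.pos (.fail r)) ∈ Y ↔
      ∃ a ∈ r.body, minus .sigmaStar (a.map .old) ∈ Y :=
  (hY _ (by simp [Lit.atom]) .deltaStar).1.trans ((hasFail_propagating hA hr).plusSingle hY)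

theorem minus_deltaStar_fail {r : Rule U L} (hr : r ∈ D.rules) :
    minus .deltaStar (.pos (.fail r)) ∈ Y ↔
      ∀ a ∈ r.body, plus .sigmaStar (a.map .old) ∈ Y :=
  (hY _ (by simp [Lit.atom]) .deltaStar).2.trans ((hasFail_propagating hA hr).minusSingle hY)

theorem plus_sigmaStar_fail {r : Rule U L} (hr : r ∈ D.rules) :
    plus .sigmaStar (.pos (.fail r)) ∈ Y ↔
      ∃ a ∈ r.body, minus .deltaStar (a.map .old) ∈ Y :=
  (hY _ (by simp [Lit.atom]) .sigmaStar).1.trans ((hasFail_propagating hA hr).plusSupport hY)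

theorem minus_sigmaStar_fail {r : Rule U L} (hr : r ∈ D.rules) :
    minus .sigmaStar (.pos (.fail r)) ∈ Y ↔
      ∀ a ∈ r.body, plus .deltaStar (a.map .old) ∈ Y :=
  (hY _ (by simp [Lit.atom]) .sigmaStar).2.trans ((hasFail_propagating hA hr).minusSupport hY)

include hp in
/-- `strict(q)` is concluded only if `q` is a strict conclusion. -/
theorem plus_Delta_of_plus_strict (hne : (D.Rs q).Nonempty) :
    (plus .deltaStar (.pos (.strict q)) ∈ Y → plus .Delta (q.map .old) ∈ Y) ∧
    (plus .sigmaStar (.pos (.strict q)) ∈ Y → plus .Delta (q.map .old) ∈ Y) := by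
  have hs := (hasOld_propagating hA).hasStrict q hne
  have h : plus .Delta (.pos (.strict q)) ∈ Y → plus .Delta (q.map .old) ∈ Y :=
    fun h' => (hp q).2 (Or.inr ((hs.plus_Delta hY).1 h'))
  exact ⟨fun h' => h (hs.plusSingle.1 ((hY _ (by simp [Lit.atom]) .deltaStar).1.1 h')),
    fun h' => h (hs.plusSupport.1 ((hY _ (by simp [Lit.atom]) .sigmaStar).1.1 h'))⟩

include hm in
/-- `strict(q)` is refuted if `q` is strictly refuted. -/
theorem minus_strict_of_minus_Delta (hne : (D.Rs q).Nonempty)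
    (h : minus .Delta (q.map .old) ∈ Y) :
    minus .deltaStar (.pos (.strict q)) ∈ Y ∧ minus .sigmaStar (.pos (.strict q)) ∈ Y := by
  have hs := (hasOld_propagating hA).hasStrict q hne
  have h' := (hs.minus_Delta hY).2 ((hm q).1 h).2
  exact ⟨(hY _ (by simp [Lit.atom]) .deltaStar).2.2 (hs.minusSingle.2 h'),
    (hY _ (by simp [Lit.atom]) .sigmaStar).2.2 (hs.minusSupport.2 h')⟩

include hp hm

omit hm in
-- Under `σ*` the literal `fail(s)` says that the body of `s` contains a literal with `-δ*`. So the
-- body of `support D r` is the support clause itself, and the condition on opponents is vacuous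
-- because no rule is superior to a rule for an old literal.
theorem plusSupport_old_iff :
    (D.translatePropagating.addFacts A).PlusSupport Y .deltaStar .sigmaStar (q.map .old) ↔
      (D.addFacts (Lit.map .old ⁻¹' A)).PlusSupport (Conclusion.map Tag.star .old ⁻¹' Y)
        .delta .sigma q := by
  change _ ↔ plus .Delta (q.map .old) ∈ Y ∨
    ∃ r ∈ D.Rsd q, (∀ a ∈ r.body, plus .sigmaStar (a.map .old) ∈ Y) ∧
      ∀ s ∈ D.R q.compl, (∃ a ∈ s.body, minus .deltaStar (a.map .old) ∈ Y) ∨ (s, r) ∉ D.sup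
  simp only [PlusSupport, exists_Rsd_propagating, Lit.map_compl]
  constructor
  · rintro (h | ⟨hne, h, -⟩ | ⟨r, hr, h, -⟩)
    · exact Or.inl h
    · exact Or.inl ((plus_Delta_of_plus_strict hA hY hp hne).2 (by simpa using h))
    · rw [forall_mem_support D hr.1] at h
      refine Or.inr ⟨r, hr, h.1, fun s hs => ?_⟩
      by_cases hsr : (s, r) ∈ D.sup
      · exact Or.inl ((plus_sigmaStar_fail hA hY hs.1).1 (h.2 s hs hsr))
      · exact Or.inr hsr
  · rintro (h | ⟨r, hr, h, h'⟩)
    · exact Or.inl h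
    · refine Or.inr (Or.inr ⟨r, hr, ?_, fun s hs => Or.inr ?_⟩)
      · exact (forall_mem_support D hr.1 _).2 ⟨h, fun s hs hsr =>
          (plus_sigmaStar_fail hA hY hs.1).2 ((h' s hs).resolve_right (not_not.2 hsr))⟩
      · exact (notMem_propagatingSup D A hs).1

omit hp in
theorem minusSupport_old_iff :
    (D.translatePropagating.addFacts A).MinusSupport Y .deltaStar .sigmaStar (q.map .old) ↔
      (D.addFacts (Lit.map .old ⁻¹' A)).MinusSupport (Conclusion.map Tag.star .old ⁻¹' Y)
        .delta .sigma q := by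
  change _ ↔ minus .Delta (q.map .old) ∈ Y ∧
    ∀ r ∈ D.Rsd q, (∃ a ∈ r.body, minus .sigmaStar (a.map .old) ∈ Y) ∨
      ∃ s ∈ D.R q.compl, (∀ a ∈ s.body, plus .deltaStar (a.map .old) ∈ Y) ∧ (s, r) ∈ D.sup
  simp only [MinusSupport, forall_Rsd_propagating, Lit.map_compl]
  refine and_congr_right fun hΔ => ?_
  constructor
  · rintro ⟨-, h⟩ r hr
    rcases h r hr with h | ⟨s, hs, -, h⟩
    · rcases (exists_mem_support D hr.1 _).1 h with h | ⟨s, hs, hsr, h⟩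
      · exact Or.inl h
      · exact Or.inr ⟨s, hs, (minus_sigmaStar_fail hA hY hs.1).1 h, hsr⟩
    · exact absurd h (notMem_propagatingSup D A hs).1
  · intro h
    refine ⟨fun hne => Or.inl ?_, fun r hr => Or.inl ((exists_mem_support D hr.1 _).2 ?_)⟩
    · simpa using (minus_strict_of_minus_Delta hA hY hm hne hΔ).2
    · exact (h r hr).imp_right fun ⟨s, hs, h, hsr⟩ =>
        ⟨s, hs, hsr, (minus_sigmaStar_fail hA hY hs.1).2 h⟩

variable (hD : D.IsDefeasible)
include hD

/-- `attack D s` is refuted under `σ*` iff the body of `s` is, or some superior non-defeater `t` has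
its body proved under `δ*`: this is clause (iii). The opponents `support D s` have larger bodies and
add no condition. Conversely, an undefeated `r` is needed so that the `fail` literals in the body of
`support D r` hold. -/
theorem plusSingle_propagating_iff :
    (D.translatePropagating.addFacts A).PlusSingle Y .deltaStar .sigmaStar (q.map .old) ↔
      (D.addFacts (Lit.map .old ⁻¹' A)).PlusTeam (Conclusion.map Tag.star .old ⁻¹' Y)
        .delta .sigma q := by
  change _ ↔ plus .Delta (q.map .old) ∈ Y ∨
    ((∃ r ∈ D.Rsd q, ∀ a ∈ r.body, plus .deltaStar (a.map .old) ∈ Y) ∧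
      minus .Delta (q.compl.map .old) ∈ Y ∧
      ∀ s ∈ D.R q.compl, (∃ a ∈ s.body, minus .sigmaStar (a.map .old) ∈ Y) ∨
        ∃ t ∈ D.Rsd q, (∀ a ∈ t.body, plus .deltaStar (a.map .old) ∈ Y) ∧ (t, s) ∈ D.sup)
  simp only [PlusSingle, exists_Rsd_propagating, Lit.map_compl]
  constructor
  · rintro (h | ⟨hne, h, -⟩ | ⟨r, hr, h1, h2, h3⟩)
    · exact Or.inl h
    · exact Or.inl ((plus_Delta_of_plus_strict hA hY hp hne).1 (by simpa using h))
    · refine Or.inr ⟨⟨r, hr, ((forall_mem_support D hr.1 _).1 h1).1⟩, h2, fun s hs => ?_⟩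
      have hat := (mem_R_propagating_old D A q.compl _).2 (Or.inr (Or.inl ⟨s, hs, rfl⟩))
      rcases h3 _ hat with h | h
      · rcases (exists_mem_attack D hs _).1 h with h | ⟨t, ht, hts, h⟩
        · exact Or.inl h
        · rw [Lit.compl_compl] at ht
          exact Or.inr ⟨t, ht, (minus_sigmaStar_fail hA hY ht.1.1).1 h, hts⟩
      · exact absurd h (notMem_propagatingSup D A hat).2
  · rintro (h | ⟨h1, h2, h3⟩)
    · exact Or.inl h
    obtain ⟨r, hr, hr1, hr2⟩ := hD.exists_undefeated q h1
      (S := fun s => ¬ ∃ a ∈ s.body, minus .sigmaStar (a.map .old) ∈ Y)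
      fun s hs hSs => (h3 s hs).resolve_left hSs
    refine Or.inr (Or.inr ⟨r, hr, (forall_mem_support D hr.1 _).2 ⟨hr1, fun s hs hsr =>
      (plus_deltaStar_fail hA hY hs.1).2 (not_not.1 (hr2 s hs hsr))⟩, h2, ?_⟩)
    rw [forall_R_propagating]
    refine ⟨fun hne => Or.inl ?_, fun s hs => Or.inl ((exists_mem_attack D hs _).2 ?_),
      fun s hs => Or.inl ((exists_mem_support D hs.1 _).2 ?_)⟩
    · simpa using (minus_strict_of_minus_Delta hA hY hm hne h2).2
    · exact (h3 s hs).imp_right fun ⟨t, ht, h, hts⟩ => ⟨t, by simpa using ht, hts,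
        (minus_sigmaStar_fail hA hY ht.1.1).2 h⟩
    · exact (h3 s hs.1).imp_right fun ⟨t, ht, h, hts⟩ => ⟨t, by simpa using ht.1, hts,
        (minus_sigmaStar_fail hA hY ht.1.1).2 h⟩

theorem minusSingle_propagating_iff :
    (D.translatePropagating.addFacts A).MinusSingle Y .deltaStar .sigmaStar (q.map .old) ↔
      (D.addFacts (Lit.map .old ⁻¹' A)).MinusTeam (Conclusion.map Tag.star .old ⁻¹' Y)
        .delta .sigma q := by
  change _ ↔ minus .Delta (q.map .old) ∈ Y ∧
    ((∀ r ∈ D.Rsd q, ∃ a ∈ r.body, minus .deltaStar (a.map .old) ∈ Y) ∨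
      plus .Delta (q.compl.map .old) ∈ Y ∨
      ∃ s ∈ D.R q.compl, (∀ a ∈ s.body, plus .sigmaStar (a.map .old) ∈ Y) ∧
        ∀ t ∈ D.Rsd q, (∃ a ∈ t.body, minus .deltaStar (a.map .old) ∈ Y) ∨ (t, s) ∉ D.sup)
  simp only [MinusSingle, forall_Rsd_propagating, Lit.map_compl]
  refine and_congr_right fun hΔ => ?_
  constructor
  · rintro ⟨-, h⟩
    -- If the clause `-δ` failed, some rule for `q` would be unrefuted and every supported rule for
    -- `∼q` would have an unrefuted superior. A maximal unrefuted `r` then contradicts the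
    -- refutation of `support D r`.
    by_contra! hcon
    obtain ⟨h1, h2, h3⟩ := hcon
    obtain ⟨r, hr, hr1, hr2⟩ := hD.exists_undefeated q
      (P := fun t => ∀ a ∈ t.body, minus .deltaStar (a.map .old) ∉ Y)
      (S := fun s => ∀ a ∈ s.body, plus .sigmaStar (a.map .old) ∈ Y) h1 h3
    -- No translated attack or support rule for `∼q` has its whole body supported: this would mean
    -- that all superior non-defeaters for `q` are refuted.
    have key : ∀ s ∈ D.R q.compl, (∀ a ∈ s.body, plus .sigmaStar (a.map .old) ∈ Y) →
        (∀ t ∈ D.Rsd q, (t, s) ∈ D.sup → plus .sigmaStar (.pos (.fail t)) ∈ Y) → False := by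
      intro s hs hs1 hs2
      obtain ⟨t, ht, htn, hts⟩ := h3 s hs hs1
      obtain ⟨a, ha, ha'⟩ := (plus_sigmaStar_fail hA hY ht.1.1).1 (hs2 t ht hts)
      exact htn a ha ha'
    rcases h r hr with h | h | h
    · rcases (exists_mem_support D hr.1 _).1 h with ⟨a, ha, h⟩ | ⟨s, hs, hsr, h⟩
      · exact hr1 a ha h
      · exact hr2 s hs hsr ((minus_deltaStar_fail hA hY hs.1).1 h)
    · exact h2 h
    · rw [exists_R_propagating] at h
      rcases h with ⟨hne, h, -⟩ | ⟨s, hs, h, -⟩ | ⟨s, hs, h, -⟩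
      · exact h2 ((plus_Delta_of_plus_strict hA hY hp hne).2 (by simpa using h))
      · rw [forall_mem_attack D hs, Lit.compl_compl] at h
        exact key s hs h.1 h.2
      · rw [forall_mem_support D hs.1, Lit.compl_compl] at h
        exact key s hs.1 h.1 fun t ht => h.2 t ht.1
  · intro h
    refine ⟨fun hne => Or.inl ?_, fun r hr => ?_⟩
    · simpa using (minus_strict_of_minus_Delta hA hY hm hne hΔ).1
    rcases h with h | h | ⟨s, hs, h1, h2⟩
    · exact Or.inl ((exists_mem_support D hr.1 _).2 (Or.inl (h r hr)))
    · exact Or.inr (Or.inl h)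
    -- The same attacker `attack D s` serves against every rule `r`.
    · have hat := (mem_R_propagating_old D A q.compl _).2 (Or.inr (Or.inl ⟨s, hs, rfl⟩))
      refine Or.inr (Or.inr ⟨_, hat, (forall_mem_attack D hs _).2 ⟨h1, fun t ht hts => ?_⟩,
        (notMem_propagatingSup D A hat).2⟩)
      rw [Lit.compl_compl] at ht
      exact (plus_sigmaStar_fail hA hY ht.1.1).2 ((h2 t ht).resolve_right (not_not.2 hts))

end

theorem simulatedBy_translatePropagating (D : Theory U L) (hD : D.IsDefeasible) :
    (D.map (PropSym.oldEmb U L)).SimulatedBy .delta .deltaStar D.translatePropagating := by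
  refine simulatedBy_of_key D D.translatePropagating {.Delta, .delta, .sigma} .delta ?_ (by simp)
    (by simp) (fun A X c hc h => infers_inter_delta _ X c hc h)
    (fun A h => hasOld_propagating h) ?_
  · rintro d (rfl | rfl | rfl) d' (rfl | rfl | rfl) e <;> simp_all [Tag.star]
  · rintro A hA Y hY hp hm (⟨d, q⟩ | ⟨d, q⟩) (rfl | rfl | rfl) hd
    · exact absurd rfl hd
    · exact plusSingle_propagating_iff hA hY hp hm hD
    · exact plusSupport_old_iff hA hY hp
    · exact absurd rfl hd
    · exact minusSingle_propagating_iff hA hY hp hm hD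
    · exact minusSupport_old_iff hA hY hm

end Translation

/-! ### Quadratic size bounds -/

theorem Finset.sum_union_le_add {α : Type*} [DecidableEq α] (s t : Finset α) (f : α → ℕ) :
    ∑ x ∈ s ∪ t, f x ≤ ∑ x ∈ s, f x + ∑ x ∈ t, f x := by
  rw [← Finset.sum_union_inter]
  exact Nat.le_add_right _ _

theorem Finset.sum_insert_le_add {α : Type*} [DecidableEq α] (a : α) (s : Finset α) (f : α → ℕ) :
    ∑ x ∈ insert a s, f x ≤ f a + ∑ x ∈ s, f x := by
  by_cases h : a ∈ s
  · rw [Finset.insert_eq_of_mem h]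
    exact Nat.le_add_left _ _
  · rw [Finset.sum_insert h]

theorem Finset.sum_biUnion_le_sum {ι α : Type*} [DecidableEq α] (s : Finset ι) (t : ι → Finset α)
    (f : α → ℕ) : ∑ x ∈ s.biUnion t, f x ≤ ∑ i ∈ s, ∑ x ∈ t i, f x := by
  classical
  induction s using Finset.induction_on with
  | empty => simp
  | insert a s ha ih =>
    rw [Finset.biUnion_insert, Finset.sum_insert ha]
    exact (Finset.sum_union_le_add _ _ _).trans (Nat.add_le_add_left ih _)

theorem Finset.sum_image_le_sum {ι α : Type*} [DecidableEq α] (s : Finset ι) (t : ι → α)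
    (f : α → ℕ) : ∑ x ∈ s.image t, f x ≤ ∑ i ∈ s, f (t i) := by
  classical
  have := Finset.sum_biUnion_le_sum s (fun i => {t i}) f
  rwa [Finset.biUnion_singleton, Finset.sum_congr rfl fun i _ => Finset.sum_singleton f (t i)]
    at this

namespace Rule

/-- The number of symbols of a rule. -/
def symbols {U L : Type*} (r : Rule U L) : ℕ := r.body.card + 3

end Rule

namespace Theory

variable {U L U' L' : Type*}

/-- The number of symbols of the rules and of the superiority relation of a theory. -/
def ruleSize (D : Theory U L) : ℕ := ∑ r ∈ D.rules, r.symbols + 3 * D.sup.card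

theorem size_eq (D : Theory U L) : D.size = D.facts.encard + (D.ruleSize : ℕ∞) := rfl

/-- A bound on the sizes of theories, from bounds on their facts and rules. -/
theorem size_le_of_ruleSize_le (D : Theory U L) (D' : Theory U' L')
    (hF : D'.facts.encard ≤ D.facts.encard) {C : ℕ} (h : D'.ruleSize ≤ C * D.ruleSize ^ 2) :
    D'.size ≤ ((C + 1 : ℕ) : ℕ∞) * D.size ^ 2 := by
  rw [size_eq, size_eq]
  have h1 : (D'.ruleSize : ℕ∞) ≤ C * (D.facts.encard + D.ruleSize) ^ 2 := by
    calc (D'.ruleSize : ℕ∞) ≤ ((C * D.ruleSize ^ 2 : ℕ) : ℕ∞) := by exact_mod_cast h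
      _ = C * (D.ruleSize : ℕ∞) ^ 2 := by push_cast; rfl
      _ ≤ _ := by gcongr; exact le_add_self
  have h2 : D'.facts.encard ≤ (D.facts.encard + D.ruleSize) ^ 2 := by
    refine (hF.trans (le_self_add (b := (D.ruleSize : ℕ∞)))).trans ?_
    generalize D.facts.encard + (D.ruleSize : ℕ∞) = x
    rcases eq_or_ne x 0 with rfl | hx
    · exact zero_le
    · exact le_self_pow₀ (Order.one_le_iff_ne_zero.2 hx) two_ne_zero
  push_cast
  rw [add_mul, one_mul, add_comm]
  exact add_le_add h1 h2

theorem card_rules_le (D : Theory U L) : 3 * D.rules.card ≤ ∑ r ∈ D.rules, r.symbols := by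
  rw [mul_comm, ← smul_eq_mul]
  exact Finset.card_nsmul_le_sum _ _ _ fun r _ => Nat.le_add_left _ _

end Theory

namespace Translation

open Theory Finset

variable {U L : Type*}

open Classical in
theorem card_oldBody_le (B : Finset (Lit U)) : (oldBody (L := L) B).card ≤ B.card :=
  card_image_le

open Classical in
theorem strictRules_subset (D : Theory U L) : strictRules D ⊆ D.rules := filter_subset _ _

open Classical in
theorem opposing_subset (D : Theory U L) : opposing D ⊆ D.rules ×ˢ D.rules := filter_subset _ _

open Classical in
theorem sum_strict_symbols_le (D : Theory U L) :
    ∑ r ∈ (strictRules D).biUnion (fun r => {ns r.head, s r, strictHead r.head}), r.symbols ≤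
      4 * ∑ r ∈ D.rules, r.symbols := by
  rw [mul_sum]
  refine (sum_biUnion_le_sum _ _ _).trans (le_trans (sum_le_sum fun r _ => ?_)
    (sum_le_sum_of_subset (strictRules_subset D)))
  refine (sum_insert_le_add _ _ _).trans ?_
  refine (Nat.add_le_add_left (sum_insert_le_add _ _ _) _).trans ?_
  have h := card_oldBody_le (L := L) r.body
  simp only [sum_singleton, Rule.symbols, ns, s, strictHead, card_empty, card_singleton]
  omega

theorem card_ruleLits_le (D : Theory U L) :
    (ruleLits D).card ≤ 2 * ∑ r ∈ D.rules, r.symbols := by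
  classical
  have h : (D.rules.biUnion fun r => insert r.head r.body).card ≤ ∑ r ∈ D.rules, r.symbols :=
    card_biUnion_le.trans (sum_le_sum fun r _ => (card_insert_le _ _).trans (by
      simp only [Rule.symbols]; omega))
  refine (card_union_le _ _).trans ?_
  rw [two_mul]
  refine add_le_add ?_ (card_image_le.trans ?_) <;> convert h

open Classical in
theorem card_main_body_le (D : Theory U L) (q : Lit U) :
    (main D q).body.card ≤ D.rules.card + 1 :=
  (card_insert_le _ _).trans (Nat.add_le_add_right
    (card_image_le.trans (card_le_card (filter_subset _ _))) _)

theorem ruleSize_translate_le (D : Theory U L) :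
    D.translate.ruleSize ≤ 40 * D.ruleSize ^ 2 := by
  classical
  set W := ∑ r ∈ D.rules, r.symbols with hW
  set N := D.rules.card with hN
  have hNW : 3 * N ≤ W := card_rules_le D
  -- The rules for pairs cost on the order of `N * W`, since each of the `N` rules can be paired
  -- with every rule.
  have hprod : ∑ x ∈ D.rules ×ˢ D.rules, (x.1.symbols + x.2.symbols) = 2 * (N * W) := by
    rw [sum_add_distrib, sum_product, sum_product]
    simp only [sum_const, ← hW, smul_eq_mul, ← hN, ← mul_sum]
    ring
  have h1 := sum_strict_symbols_le D
  have h2 : ∑ r ∈ (opposing D).biUnion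
      (fun x => {R1 x.1 x.2, R2 x.1 x.2, R3 x.1 x.2, viaDefeat x.1 x.2}), r.symbols ≤
      3 * (2 * (N * W)) := by
    rw [← hprod, mul_sum]
    refine (sum_biUnion_le_sum _ _ _).trans (le_trans (sum_le_sum fun x _ => ?_)
      (sum_le_sum_of_subset (opposing_subset D)))
    refine (sum_insert_le_add _ _ _).trans ?_
    refine (Nat.add_le_add_left (sum_insert_le_add _ _ _) _).trans ?_
    refine (Nat.add_le_add_left (Nat.add_le_add_left (sum_insert_le_add _ _ _) _) _).trans ?_
    have h := card_oldBody_le (L := L) x.1.body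
    have h' := card_oldBody_le (L := L) x.2.body
    -- The four rules have at most `|Bᵢ| + |Bⱼ| + 14` symbols, and `14 ≤ 3 * 6`.
    simp only [sum_singleton, Rule.symbols, R1, R2, R3, viaDefeat, card_singleton]
    omega
  have h3 : ∑ r ∈ D.rules.biUnion (fun r => {viaFail r, NF r, F r}), r.symbols ≤ 4 * W := by
    rw [hW, mul_sum]
    refine (sum_biUnion_le_sum _ _ _).trans (sum_le_sum fun r _ => ?_)
    refine (sum_insert_le_add _ _ _).trans ?_
    refine (Nat.add_le_add_left (sum_insert_le_add _ _ _) _).trans ?_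
    have h := card_oldBody_le (L := L) r.body
    simp only [sum_singleton, Rule.symbols, viaFail, NF, F, card_empty, card_singleton]
    omega
  have h4 : ∑ r ∈ (D.rules.filter fun r => r.arrow ≠ .defeater).image one, r.symbols ≤ W := by
    refine (sum_image_le_sum _ _ _).trans (le_trans (sum_le_sum fun r _ => ?_)
      (sum_le_sum_of_subset (filter_subset _ _)))
    exact Nat.add_le_add_right (card_oldBody_le _) _
  have h5 : ∑ r ∈ (ruleLits D).image (main D), r.symbols ≤ 2 * W * (N + 4) := by
    refine (sum_image_le_sum _ _ _).trans ((sum_le_card_nsmul _ _ (N + 4) fun q _ => ?_).trans ?_)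
    · have := card_main_body_le D q
      simp only [Rule.symbols]
      omega
    · exact Nat.mul_le_mul_right _ (card_ruleLits_le D)
  have hrules : ∑ r ∈ rules D, r.symbols ≤
      4 * W + 3 * (2 * (N * W)) + 4 * W + W + 2 * W * (N + 4) := by
    refine (sum_union_le_add _ _ _).trans (add_le_add ?_ (by convert h5))
    refine (sum_union_le_add _ _ _).trans (add_le_add ?_ (by convert h4))
    refine (sum_union_le_add _ _ _).trans (add_le_add ?_ (by convert h3))
    exact (sum_union_le_add _ _ _).trans (add_le_add (by convert h1) (by convert h2))
  have hopp : (opposing D).card ≤ N * N :=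
    (card_le_card (opposing_subset D)).trans (card_product _ _).le
  have hsup : (Translation.sup D).card ≤ N + N * N + N * N + N := by
    refine (card_union_le _ _).trans (add_le_add ?_ card_image_le)
    refine (card_union_le _ _).trans (add_le_add ?_ (card_image_le.trans hopp))
    refine (card_union_le _ _).trans (add_le_add
      (card_image_le.trans (card_le_card (strictRules_subset D)))
      (card_image_le.trans ((card_le_card (filter_subset _ _)).trans hopp)))
  have hW2 : W ≤ D.ruleSize := Nat.le_add_right _ _
  have e : D.translate.ruleSize ≤ 40 * W ^ 2 := by
    change ∑ r ∈ rules D, r.symbols + 3 * (Translation.sup D).card ≤ _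
    have hNN : N ≤ W := by omega
    have a1 : N * W ≤ W * W := Nat.mul_le_mul_right _ hNN
    have a2 : N * N ≤ W * W := Nat.mul_le_mul hNN hNN
    have a3 : W ≤ W * W := Nat.le_mul_self W
    -- The total is at most `17 W + 8 N W + 6 N + 6 N²`, hence at most `37 W²`.
    nlinarith
  exact e.trans (Nat.mul_le_mul_left _ (Nat.pow_le_pow_left hW2 2))

theorem ruleSize_translatePropagating_le (D : Theory U L) :
    D.translatePropagating.ruleSize ≤ 40 * D.ruleSize ^ 2 := by
  classical
  set W := ∑ r ∈ D.rules, r.symbols with hW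
  set N := D.rules.card with hN
  have hNW : 3 * N ≤ W := card_rules_le D
  have h1 := sum_strict_symbols_le D
  have h2 : ∑ r ∈ D.rules.biUnion (fun r => {NF r, F r, attack D r}), r.symbols ≤
      4 * W + N * N := by
    have e : 4 * W + N * N = ∑ r ∈ D.rules, (4 * r.symbols + N) := by
      rw [sum_add_distrib, ← mul_sum, sum_const, smul_eq_mul]
    rw [e]
    refine (sum_biUnion_le_sum _ _ _).trans (sum_le_sum fun r _ => ?_)
    refine (sum_insert_le_add _ _ _).trans ?_
    refine (Nat.add_le_add_left (sum_insert_le_add _ _ _) _).trans ?_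
    have h := card_oldBody_le (L := L) r.body
    have h' : (attack D r).body.card ≤ r.body.card + N := (card_union_le _ _).trans
      (add_le_add h (card_image_le.trans (card_le_card (filter_subset _ _))))
    simp only [sum_singleton, Rule.symbols, NF, F, card_empty]
    omega
  have h3 : ∑ r ∈ (D.rules.filter fun r => r.arrow ≠ .defeater).image (support D), r.symbols ≤
      W + N * N := by
    have e : W + N * N = ∑ r ∈ D.rules, (r.symbols + N) := by
      rw [sum_add_distrib, sum_const, smul_eq_mul]
    rw [e]
    refine (sum_image_le_sum _ _ _).trans (le_trans (sum_le_sum fun r _ => ?_)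
      (sum_le_sum_of_subset (filter_subset _ _)))
    have h' : (support D r).body.card ≤ r.body.card + N := (card_union_le _ _).trans
      (add_le_add (card_oldBody_le _) (card_image_le.trans (card_le_card (filter_subset _ _))))
    simp only [Rule.symbols]
    omega
  have hrules : ∑ r ∈ propagatingRules D, r.symbols ≤
      4 * W + (4 * W + N * N) + (W + N * N) := by
    refine (sum_union_le_add _ _ _).trans (add_le_add ?_ (by convert h3))
    exact (sum_union_le_add _ _ _).trans (add_le_add (by convert h1) (by convert h2))
  have hsup : (propagatingSup D).card ≤ N + N :=
    (card_union_le _ _).trans (add_le_add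
      (card_image_le.trans (card_le_card (strictRules_subset D))) card_image_le)
  have hW2 : W ≤ D.ruleSize := Nat.le_add_right _ _
  have e : D.translatePropagating.ruleSize ≤ 40 * W ^ 2 := by
    change ∑ r ∈ propagatingRules D, r.symbols + 3 * (propagatingSup D).card ≤ _
    have hNN : N ≤ W := by omega
    have a2 : N * N ≤ W * W := Nat.mul_le_mul hNN hNN
    have a3 : W ≤ W * W := Nat.le_mul_self W
    -- The total is at most `9 W + 2 N² + 6 N`, hence at most `17 W²`; the constant 40 is kept so
    -- that both translations share one bound.
    nlinarith
  exact e.trans (Nat.mul_le_mul_left _ (Nat.pow_le_pow_left hW2 2))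

theorem size_translate_le (D : Theory U L) : D.translate.size ≤ (41 : ℕ) * D.size ^ 2 :=
  size_le_of_ruleSize_le D _ (Set.encard_image_le _ _) (ruleSize_translate_le D)

theorem size_translatePropagating_le (D : Theory U L) :
    D.translatePropagating.size ≤ (41 : ℕ) * D.size ^ 2 :=
  size_le_of_ruleSize_le D _ (Set.encard_image_le _ _) (ruleSize_translatePropagating_le D)

/-- The labels of the superior rules of the translations. -/
def IsSuperior : TLabel U L → Prop
  | .ns _ | .R2 _ _ | .R3 _ _ | .NF _ => True
  | _ => False

end Translation

/-! ### The translations are defeasible theories -/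

namespace Theory

/-- A relation whose left elements are never right elements is acyclic. -/
theorem not_transGen_of_separated {α : Type*} {rel : α → α → Prop} (P : α → Prop)
    (h : ∀ a b, rel a b → P a ∧ ¬ P b) (a : α) : ¬ Relation.TransGen rel a a := by
  intro ha
  obtain ⟨b, hb, -⟩ := Relation.TransGen.head'_iff.1 ha
  obtain ⟨c, -, hc⟩ := Relation.TransGen.tail'_iff.1 ha
  exact (h _ _ hc).2 (h _ _ hb).1

open Translation

variable {U L : Type*} {D : Theory U L}

theorem IsDefeasible.translate (hD : D.IsDefeasible) : D.translate.IsDefeasible where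
  facts_mem := by
    rintro _ ⟨q, hq, rfl⟩
    exact Or.inl ⟨q.atom, hD.facts_mem q hq, (Lit.atom_map _ q).symm⟩
  head_mem r hr := Or.inr ⟨r, hr, Or.inl rfl⟩
  body_mem r hr a ha := Or.inr ⟨r, hr, Or.inr ⟨a, ha, rfl⟩⟩
  sup_mem x hx := by
    change x.1 ∈ Translation.rules D ∧ x.2 ∈ Translation.rules D
    rw [mem_rules, mem_rules]
    -- Adding facts does not change the superiority relation, so the description for the empty set
    -- of added facts serves here.
    rcases (mem_sup_iff D ∅ x).1 hx with ⟨r, hr, rfl⟩ | ⟨y, hy, -, rfl⟩ | ⟨y, hy, rfl⟩ |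
      ⟨r, hr, rfl⟩
    · exact ⟨Or.inl (Or.inl (Or.inl (Or.inl ⟨r, hr, by simp⟩))),
        Or.inl (Or.inl (Or.inl (Or.inl ⟨r, hr, by simp⟩)))⟩
    · exact ⟨Or.inl (Or.inl (Or.inl (Or.inr ⟨y, hy, by simp⟩))),
        Or.inl (Or.inl (Or.inl (Or.inr ⟨y, hy, by simp⟩)))⟩
    · exact ⟨Or.inl (Or.inl (Or.inl (Or.inr ⟨y, hy, by simp⟩))),
        Or.inl (Or.inl (Or.inl (Or.inr ⟨y, hy, by simp⟩)))⟩
    · exact ⟨Or.inl (Or.inl (Or.inr ⟨r, hr, by simp⟩)),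
        Or.inl (Or.inl (Or.inr ⟨r, hr, by simp⟩))⟩
  acyclic := not_transGen_of_separated (fun r => IsSuperior r.label) fun a b hab => by
    rcases (mem_sup_iff D ∅ _).1 hab with ⟨r, -, e⟩ | ⟨y, -, -, e⟩ | ⟨y, -, e⟩ | ⟨r, -, e⟩ <;>
      obtain ⟨rfl, rfl⟩ := Prod.mk.injEq .. ▸ e <;>
      simp [IsSuperior, ns, s, R1, R2, R3, NF, F]

theorem IsDefeasible.translatePropagating (hD : D.IsDefeasible) :
    D.translatePropagating.IsDefeasible where
  facts_mem := by
    rintro _ ⟨q, hq, rfl⟩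
    exact Or.inl ⟨q.atom, hD.facts_mem q hq, (Lit.atom_map _ q).symm⟩
  head_mem r hr := Or.inr ⟨r, hr, Or.inl rfl⟩
  body_mem r hr a ha := Or.inr ⟨r, hr, Or.inr ⟨a, ha, rfl⟩⟩
  sup_mem x hx := by
    change x.1 ∈ propagatingRules D ∧ x.2 ∈ propagatingRules D
    rw [mem_propagatingRules, mem_propagatingRules]
    rcases (mem_propagatingSup_iff D ∅ x).1 hx with ⟨r, hr, rfl⟩ | ⟨r, hr, rfl⟩
    · exact ⟨Or.inl (Or.inl ⟨r, hr, by simp⟩), Or.inl (Or.inl ⟨r, hr, by simp⟩)⟩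
    · exact ⟨Or.inl (Or.inr ⟨r, hr, by simp⟩), Or.inl (Or.inr ⟨r, hr, by simp⟩)⟩
  acyclic := not_transGen_of_separated (fun r => IsSuperior r.label) fun a b hab => by
    rcases (mem_propagatingSup_iff D ∅ _).1 hab with ⟨r, -, e⟩ | ⟨r, -, e⟩ <;>
      obtain ⟨rfl, rfl⟩ := Prod.mk.injEq .. ▸ e <;>
      simp [IsSuperior, ns, s, NF, F]

end Theory

theorem mainTheorem1 :
    ∃ C : ℕ,
      CanBeSimulatedWithin.{u} (fun n => C * n ^ 2) .partial_ .partialStar ∧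
      CanBeSimulatedWithin.{u} (fun n => C * n ^ 2) .delta .deltaStar ∧
      ∀ (U L : Type u) (D : Theory U L), D.IsDefeasible →
        D.translate.IsDefeasible ∧
        D.translate.size ≤ C * D.size ^ 2 ∧
        (D.map (PropSym.oldEmb U L)).SimulatedBy .partial_ .partialStar D.translate :=
  ⟨41,
    fun U L D hD => ⟨PropSym U L, TLabel U L, PropSym.oldEmb U L, D.translate, hD.translate,
      Translation.size_translate_le D, Translation.simulatedBy_translate D hD⟩,
    fun U L D hD => ⟨PropSym U L, TLabel U L, PropSym.oldEmb U L, D.translatePropagating,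
      hD.translatePropagating, Translation.size_translatePropagating_le D,
      Translation.simulatedBy_translatePropagating D hD⟩,
    fun _ _ D hD => ⟨hD.translate, Translation.size_translate_le D,
      Translation.simulatedBy_translate D hD⟩⟩
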